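/- Theorem (Optimal strategies for Problem \#1). Let $k^2>0$, $\sigma^2>0$, let $x_0$ and $v$ be independent real random variables on a probability space $(\Omega,\mathcal F,\mathbb P)$, where $v\sim G(0,\sigma^2)$ is Gaussian and $x_0$ has an arbitrary distribution $\mathbf P_{x_0}$ with $\mathbf E\,x_0^2<\infty$. An admissible pair is a pair $\gamma=(\gamma_1,\gamma_2)$ of Borel measurable functions $\mathbb R\to\mathbb R$; put $\overline\gamma_1(x)=x+\gamma_1(x)$, $y_1=\overline\gamma_1(x_0)+v$, and $$J(\gamma)=\mathbf E\big\{k^2\gamma_1(x_0)^2+(\overline\gamma_1(x_0)-\gamma_2(y_1))^2\big\}\in[0,\infty].$$ The pair $\gamma$ is optimal if $J(\gamma)=\inf_\delta J(\delta)$ over all admissible pairs $\delta$. Then the following hold. (i) Let $$\Lambda^{u_1}(x_0,y_1)=\frac{\exp\{-(y_1-x_0-u_1)^2/(2\sigma^2)\}}{\exp\{-y_1^2/(2\sigma^2)\}}>0 .$$ For all $x_0,u_1\in\mathbb R$ the law of $x_0+u_1+v$ ($x_0,u_1$ fixed) is absolutely continuous with respect to the law $\mathbf P_v$ of $v$, with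 Radon–Nikodym derivative $\Lambda^{u_1}(x_0,\cdot)$. For every admissible $\gamma$ the law of $(x_0,y_1)$ is absolutely continuous with respect to $\mathbf P_{x_0}\otimes\mathbf P_v$, with Radon–Nikodym derivative $(x_0,y_1)\mapsto\Lambda^{\gamma_1(x_0)}(x_0,y_1)$. (ii) An optimal admissible pair exists. (iii) Every optimal admissible pair $\gamma$ satisfies each of the following systems, where all random variables that are conditioned and all integrands are integrable. (A) With $u_1=\gamma_1(x_0)$, almost surely, $$\mathbf E\Big\{\tfrac{y_1-x_0-u_1}{\sigma^2}\big(k^2u_1^2+(x_0+u_1-\gamma_2(y_1))^2\big)+2k^2u_1+2(x_0+u_1-\gamma_2(y_1))\,\Big|\,x_0\Big\}=0,$$ $$\mathbf E\{x_0+\gamma_1(x_0)-\gamma_2(y_1)\,|\,y_1\}=0 .$$ (B) Almost surely, $$\gamma_1(x_0)=-\tfrac1{k^2}\mathbf E\{x_0+\gamma_1(x_0)-\gamma_2(y_1)|x_0\}-\tfrac1{2k^2\sigma^2}\mathbf E\{(y_1-x_0-\gamma_1(x_0))(x_0+\gamma_1(x_0)-\gamma_2(y_1))^2|x_0\},$$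 $$\gamma_2(y_1)=\mathbf E\{x_0+\gamma_1(x_0)|y_1\}.$$ (C) Almost surely, $$\overline\gamma_1(x_0)=x_0-\tfrac1{k^2}\mathbf E\{\overline\gamma_1(x_0)-\gamma_2(y_1)|x_0\}-\tfrac1{2k^2\sigma^2}\mathbf E\{(y_1-\overline\gamma_1(x_0))(\overline\gamma_1(x_0)-\gamma_2(y_1))^2|x_0\},$$ $$\gamma_2(y_1)=\mathbf E\{\overline\gamma_1(x_0)|y_1\}.$$ (D) For $\mathbf P_{x_0}$-almost every $x$, and for Lebesgue-almost every $y$ (equivalently, almost every $y$ with respect to the law of $y_1$), respectively, $$\overline\gamma_1(x)=x-\frac1{k^2}\int_{-\infty}^{\infty}\Big\{\frac{(\zeta-\overline\gamma_1(x))(\overline\gamma_1(x)-\gamma_2(\zeta))^2}{2\sigma^2}+(\overline\gamma_1(x)-\gamma_2(\zeta))\Big\}\frac{\exp(-\frac{(\zeta-\overline\gamma_1(x))^2}{2\sigma^2})}{\sqrt{2\pi\sigma^2}}\,d\zeta,$$ $$\gamma_2(y)=\frac{\int\overline\gamma_1(\xi)\exp(-\frac{(y-\overline\gamma_1(\xi))^2}{2\sigma^2})\,\mathbf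 P_{x_0}(d\xi)}{\int\exp(-\frac{(y-\overline\gamma_1(\xi))^2}{2\sigma^2})\,\mathbf P_{x_0}(d\xi)} .$$ Moreover, for every admissible pair with $J(\gamma)<\infty$, the systems (A), (B), (C), (D) (each including the stated integrability) are equivalent. -/

import Mathlib

open MeasureTheory ProbabilityTheory
open scoped ENNReal

namespace Witsenhausen

/-- An admissible pair of strategies: a pair of Borel measurable functions, `u₁ = γ₁ (x₀)` and
`u₂ = γ₂ (y₁)`. -/
structure Strategy where
  γ₁ : ℝ → ℝ
  γ₂ : ℝ → ℝ
  measurable_γ₁ : Measurable γ₁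
  measurable_γ₂ : Measurable γ₂

/-- `x ↦ x + γ₁ x`, the first strategy in Witsenhausen's reformulation. -/
def Strategy.bar₁ (γ : Strategy) : ℝ → ℝ := fun x => x + γ.γ₁ x

section Problem

variable {Ω : Type*}

/-- The state `x₁ = x₀ + u₁`. -/
def state₁ (x₀ : Ω → ℝ) (γ : Strategy) : Ω → ℝ := fun ω => x₀ ω + γ.γ₁ (x₀ ω)

/-- The observation `y₁ = x₁ + v`. -/
def obs (x₀ v : Ω → ℝ) (γ : Strategy) : Ω → ℝ := fun ω => state₁ x₀ γ ω + v ω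

/-- The state `x₂ = x₁ - u₂`. -/
def state₂ (x₀ v : Ω → ℝ) (γ : Strategy) : Ω → ℝ :=
  fun ω => state₁ x₀ γ ω - γ.γ₂ (obs x₀ v γ ω)

variable [MeasurableSpace Ω]

/-- The average payoff `E (k² u₁² + x₂²)`, with values in `[0, ∞]`. -/
noncomputable def payoff (P : Measure Ω) (x₀ v : Ω → ℝ) (k : ℝ) (γ : Strategy) : ℝ≥0∞ :=
  ∫⁻ ω, ENNReal.ofReal (k ^ 2 * (γ.γ₁ (x₀ ω)) ^ 2 + (state₂ x₀ v γ ω) ^ 2) ∂P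

/-- The pair `γ` attains the infimum of the payoff over all admissible pairs. -/
def IsOptimal (P : Measure Ω) (x₀ v : Ω → ℝ) (k : ℝ) (γ : Strategy) : Prop :=
  payoff P x₀ v k γ = ⨅ δ : Strategy, payoff P x₀ v k δ

/-- The law of `(x₀, y₁)` under the original measure, when the pair `γ` is used. -/
noncomputable def originalLaw (P : Measure Ω) (x₀ v : Ω → ℝ) (γ : Strategy) : Measure (ℝ × ℝ) :=
  P.map (fun ω => (x₀ ω, obs x₀ v γ ω))

/-- The law of `(x₀, y₁)` under the reference measure: `x₀` and `y₁` are independent, and `y₁` has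
the law of `v`. -/
noncomputable def referenceLaw (P : Measure Ω) (x₀ v : Ω → ℝ) : Measure (ℝ × ℝ) :=
  (P.map x₀).prod (P.map v)

/-- The conditional law of `y₁` given `x₀ = x` and `u₁ = u`. -/
noncomputable def channel (P : Measure Ω) (v : Ω → ℝ) (x u : ℝ) : Measure ℝ :=
  P.map (fun ω => x + u + v ω)

/-- The bracket in the stationarity condition of the first controller. -/
noncomputable def bracket (k σ : ℝ) (γ₂ : ℝ → ℝ) (x u y : ℝ) : ℝ :=
  (y - x - u) / σ ^ 2 * (k ^ 2 * u ^ 2 + (x + u - γ₂ y) ^ 2) + 2 * k ^ 2 * u + 2 * (x + u - γ₂ y)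

/-- The two stationarity conditions, as conditional expectations given `x₀` and given `y₁`; the
conditioned random variables are required to be integrable. -/
def Stationary (P : Measure Ω) (x₀ v : Ω → ℝ) (k σ : ℝ) (γ : Strategy) : Prop :=
  (Integrable (fun ω => bracket k σ γ.γ₂ (x₀ ω) (γ.γ₁ (x₀ ω)) (obs x₀ v γ ω)) P ∧
    P[fun ω => bracket k σ γ.γ₂ (x₀ ω) (γ.γ₁ (x₀ ω)) (obs x₀ v γ ω) |
      MeasurableSpace.comap x₀ inferInstance] =ᵐ[P] 0) ∧
  (Integrable (fun ω => x₀ ω + γ.γ₁ (x₀ ω) - γ.γ₂ (obs x₀ v γ ω)) P ∧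
    P[fun ω => x₀ ω + γ.γ₁ (x₀ ω) - γ.γ₂ (obs x₀ v γ ω) |
      MeasurableSpace.comap (obs x₀ v γ) inferInstance] =ᵐ[P] 0)

/-- The conditional-expectation equations solved for `γ₁ (x₀)` and `γ₂ (y₁)`. -/
def CondEqs (P : Measure Ω) (x₀ v : Ω → ℝ) (k σ : ℝ) (γ : Strategy) : Prop :=
  (Integrable (fun ω => x₀ ω + γ.γ₁ (x₀ ω) - γ.γ₂ (obs x₀ v γ ω)) P ∧
    Integrable (fun ω => (obs x₀ v γ ω - x₀ ω - γ.γ₁ (x₀ ω)) *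
      (x₀ ω + γ.γ₁ (x₀ ω) - γ.γ₂ (obs x₀ v γ ω)) ^ 2) P ∧
    ∀ᵐ ω ∂P, γ.γ₁ (x₀ ω) =
      - (1 / k ^ 2) * (P[fun ω' => x₀ ω' + γ.γ₁ (x₀ ω') - γ.γ₂ (obs x₀ v γ ω') |
          MeasurableSpace.comap x₀ inferInstance]) ω
      - 1 / (2 * k ^ 2 * σ ^ 2) *
        (P[fun ω' => (obs x₀ v γ ω' - x₀ ω' - γ.γ₁ (x₀ ω')) *
            (x₀ ω' + γ.γ₁ (x₀ ω') - γ.γ₂ (obs x₀ v γ ω')) ^ 2 |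
          MeasurableSpace.comap x₀ inferInstance]) ω) ∧
  (Integrable (fun ω => x₀ ω + γ.γ₁ (x₀ ω)) P ∧
    ∀ᵐ ω ∂P, γ.γ₂ (obs x₀ v γ ω) =
      (P[fun ω' => x₀ ω' + γ.γ₁ (x₀ ω') | MeasurableSpace.comap (obs x₀ v γ) inferInstance]) ω)

/-- The same equations written for the pair `(γ.bar₁, γ.γ₂)`. -/
def CondEqsBar (P : Measure Ω) (x₀ v : Ω → ℝ) (k σ : ℝ) (γ : Strategy) : Prop :=
  (Integrable (fun ω => γ.bar₁ (x₀ ω) - γ.γ₂ (obs x₀ v γ ω)) P ∧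
    Integrable (fun ω => (obs x₀ v γ ω - γ.bar₁ (x₀ ω)) *
      (γ.bar₁ (x₀ ω) - γ.γ₂ (obs x₀ v γ ω)) ^ 2) P ∧
    ∀ᵐ ω ∂P, γ.bar₁ (x₀ ω) = x₀ ω
      - 1 / k ^ 2 * (P[fun ω' => γ.bar₁ (x₀ ω') - γ.γ₂ (obs x₀ v γ ω') |
          MeasurableSpace.comap x₀ inferInstance]) ω
      - 1 / (2 * k ^ 2 * σ ^ 2) *
        (P[fun ω' => (obs x₀ v γ ω' - γ.bar₁ (x₀ ω')) *
            (γ.bar₁ (x₀ ω') - γ.γ₂ (obs x₀ v γ ω')) ^ 2 |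
          MeasurableSpace.comap x₀ inferInstance]) ω) ∧
  (Integrable (fun ω => γ.bar₁ (x₀ ω)) P ∧
    ∀ᵐ ω ∂P, γ.γ₂ (obs x₀ v γ ω) =
      (P[fun ω' => γ.bar₁ (x₀ ω') | MeasurableSpace.comap (obs x₀ v γ) inferInstance]) ω)

end Problem

/-- The explicit Gaussian ratio `Λ`, as a function of `x₀`, `u₁`, `y₁`. -/
noncomputable def gaussianRatio (σ x u y : ℝ) : ℝ :=
  Real.exp (-(y - x - u) ^ 2 / (2 * σ ^ 2)) / Real.exp (-y ^ 2 / (2 * σ ^ 2))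

/-- The integrand of the first integral equation, at `b = γ.bar₁ x`. -/
noncomputable def kernel₁ (σ : ℝ) (γ₂ : ℝ → ℝ) (b ζ : ℝ) : ℝ :=
  ((ζ - b) * (b - γ₂ ζ) ^ 2 / (2 * σ ^ 2) + (b - γ₂ ζ)) *
    (Real.exp (-(ζ - b) ^ 2 / (2 * σ ^ 2)) / Real.sqrt (2 * Real.pi * σ ^ 2))

/-- The two coupled integral equations for `(γ.bar₁, γ.γ₂)`, where `μ` is the law of `x₀`: the first
for `μ`-almost every `x`, the second for Lebesgue-almost every `y` (the law of `y₁` and Lebesgue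
measure have the same null sets), with absolutely convergent integrals. -/
def IntegralEqs (μ : Measure ℝ) (k σ : ℝ) (γ : Strategy) : Prop :=
  (∀ᵐ x ∂μ, Integrable (fun ζ => kernel₁ σ γ.γ₂ (γ.bar₁ x) ζ) volume ∧
    γ.bar₁ x = x - 1 / k ^ 2 * ∫ ζ, kernel₁ σ γ.γ₂ (γ.bar₁ x) ζ) ∧
  (∀ᵐ y ∂(volume : Measure ℝ),
    Integrable (fun ξ => γ.bar₁ ξ * Real.exp (-(y - γ.bar₁ ξ) ^ 2 / (2 * σ ^ 2))) μ ∧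
    γ.γ₂ y = (∫ ξ, γ.bar₁ ξ * Real.exp (-(y - γ.bar₁ ξ) ^ 2 / (2 * σ ^ 2)) ∂μ) /
      ∫ ξ, Real.exp (-(y - γ.bar₁ ξ) ^ 2 / (2 * σ ^ 2)) ∂μ)

end Witsenhausen

namespace Witsenhausen
open Filter Topology

/-! By independence the payoff is a double integral `cost μ σ k g h` in `g = γ.bar₁` and `h = γ.γ₂`,
and it can be minimized in each variable separately. For fixed `g`, completing the square at each
`y` shows that the posterior mean is the best `h`, with an explicit excess for any other
(`cost_eq_cost_posteriorMean_add`). For fixed `h` of linear growth, the first controller minimizes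
`k² (u - x)² + missCost σ h u` separately for each `x`. The cross term `-2 k² u x` forces every
selection of minimizers to be monotone (`exists_monotone_bestResponse`). The two steps combine
because the posterior mean of an arbitrary measurable `g`, without any moment, grows at most
linearly (`exists_abs_posteriorMean_le`).

Existence is then the direct method. A minimizing sequence may be taken monotone in its first
component, and Helly's theorem in `EReal` gives a pointwise limit. The quadratic penalty keeps that
limit finite almost everywhere, posterior means pass to the limit by dominated convergence, and
Fatou's lemma gives lower semicontinuity.

At an optimum the excess vanishes, so `h` is the posterior mean almost everywhere. Comparison with
the monotone best response shows that `g x` minimizes pointwise for almost every `x`, and Fermat's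
rule gives the first integral equation, since `missCost` has derivative `2 ∫ kernel₁`.

The systems are equivalent because conditioning on `x₀` is integration against a Gaussian centred at
`γ.bar₁ x₀`, and conditioning on `y₁` is Bayes' formula. The extra term `u₁² (y₁ - x₀ - u₁)` of the
stationarity bracket has conditional mean zero. Linear growth also supplies the integrability of the
cubic term. -/

/-- The unnormalized Gaussian density with mean `b` and variance `σ ^ 2`. -/
noncomputable def bell (σ b y : ℝ) : ℝ := Real.exp (-(y - b) ^ 2 / (2 * σ ^ 2))

/-- The unnormalized density at `y` of a Gaussian perturbation of `g`. -/
noncomputable def evidence (μ : Measure ℝ) (σ : ℝ) (g : ℝ → ℝ) (y : ℝ) : ℝ :=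
  ∫ ξ, bell σ (g ξ) y ∂μ

/-- The conditional mean of `g` given that its Gaussian perturbation equals `y`. -/
noncomputable def posteriorMean (μ : Measure ℝ) (σ : ℝ) (g : ℝ → ℝ) (y : ℝ) : ℝ :=
  (∫ ξ, g ξ * bell σ (g ξ) y ∂μ) / evidence μ σ g y

/-! ### Bounds on the Gaussian kernel, uniform in its centre -/

lemma bell_pos (σ b y : ℝ) : 0 < bell σ b y := Real.exp_pos _

lemma bell_le_one (σ b y : ℝ) : bell σ b y ≤ 1 := by
  rw [bell, Real.exp_le_one_iff, neg_div, neg_nonpos]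
  positivity

lemma continuous_bell (σ : ℝ) : Continuous fun p : ℝ × ℝ => bell σ p.1 p.2 := by
  unfold bell
  fun_prop

lemma measurable_bell (σ : ℝ) : Measurable fun p : ℝ × ℝ => bell σ p.1 p.2 :=
  (continuous_bell σ).measurable

/-- This is `t * exp (-t) ≤ 1`. Uniformity in `b` is what later removes every moment condition on
`g`. -/
lemma sq_mul_bell_le {σ : ℝ} (hσ : 0 < σ ^ 2) (b y : ℝ) :
    (y - b) ^ 2 * bell σ b y ≤ 2 * σ ^ 2 := by
  have h := Real.add_one_le_exp ((y - b) ^ 2 / (2 * σ ^ 2))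
  have h2 : (y - b) ^ 2 ≤ 2 * σ ^ 2 * Real.exp ((y - b) ^ 2 / (2 * σ ^ 2)) := by
    have : (y - b) ^ 2 = 2 * σ ^ 2 * ((y - b) ^ 2 / (2 * σ ^ 2)) :=
      (mul_div_cancel₀ _ (by positivity)).symm
    calc (y - b) ^ 2 = 2 * σ ^ 2 * ((y - b) ^ 2 / (2 * σ ^ 2)) := this
      _ ≤ _ := by gcongr; linarith
  calc (y - b) ^ 2 * bell σ b y
      ≤ 2 * σ ^ 2 * Real.exp ((y - b) ^ 2 / (2 * σ ^ 2)) * bell σ b y := by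
        gcongr; exact (bell_pos _ _ _).le
    _ = 2 * σ ^ 2 := by
        rw [bell, mul_assoc, ← Real.exp_add, neg_div, add_neg_cancel, Real.exp_zero, mul_one]

lemma sub_sq_mul_bell_le {σ : ℝ} (hσ : 0 < σ ^ 2) (b c y : ℝ) :
    (b - c) ^ 2 * bell σ b y ≤ 4 * σ ^ 2 + 2 * (y - c) ^ 2 := by
  have h1 := sq_mul_bell_le hσ b y
  have h2 := bell_le_one σ b y
  have h0 := (bell_pos σ b y).le
  have h3 : (b - c) ^ 2 ≤ 2 * (y - b) ^ 2 + 2 * (y - c) ^ 2 := by nlinarith [sq_nonneg (y - b + (y - c))]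
  calc (b - c) ^ 2 * bell σ b y ≤ (2 * (y - b) ^ 2 + 2 * (y - c) ^ 2) * bell σ b y := by gcongr
    _ = 2 * ((y - b) ^ 2 * bell σ b y) + 2 * (y - c) ^ 2 * bell σ b y := by ring
    _ ≤ 2 * (2 * σ ^ 2) + 2 * (y - c) ^ 2 * 1 := by gcongr
    _ = _ := by ring

lemma abs_mul_bell_le {σ : ℝ} (hσ : 0 < σ ^ 2) (b y : ℝ) :
    |b * bell σ b y| ≤ 1 + (4 * σ ^ 2 + 2 * y ^ 2) := by
  have h1 := sub_sq_mul_bell_le hσ b 0 y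
  have h2 := bell_le_one σ b y
  have h0 := (bell_pos σ b y).le
  rw [abs_mul, abs_of_nonneg h0]
  have h3 : |b| ≤ 1 + b ^ 2 := by nlinarith [sq_abs b, sq_nonneg (|b| - 1)]
  calc |b| * bell σ b y ≤ (1 + b ^ 2) * bell σ b y := by gcongr
    _ = bell σ b y + (b - 0) ^ 2 * bell σ b y := by ring
    _ ≤ 1 + (4 * σ ^ 2 + 2 * (y - 0) ^ 2) := by gcongr
    _ = _ := by ring

/-! ### Posterior means: optimality, continuity and linear growth -/

section Posterior

variable {μ : Measure ℝ} {σ : ℝ} {g : ℝ → ℝ}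

lemma measurable_bell_comp (hg : Measurable g) (y : ℝ) : Measurable fun ξ => bell σ (g ξ) y :=
  (measurable_bell σ).comp (hg.prodMk measurable_const)

lemma integrable_bell [IsFiniteMeasure μ] (hg : Measurable g) (y : ℝ) :
    Integrable (fun ξ => bell σ (g ξ) y) μ :=
  Integrable.of_bound (measurable_bell_comp hg y).aestronglyMeasurable 1
    (ae_of_all _ fun ξ => by
      rw [Real.norm_of_nonneg (bell_pos _ _ _).le]; exact bell_le_one _ _ _)

lemma integrable_mul_bell [IsFiniteMeasure μ] (hσ : 0 < σ ^ 2) (hg : Measurable g) (y : ℝ) :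
    Integrable (fun ξ => g ξ * bell σ (g ξ) y) μ :=
  Integrable.of_bound (hg.mul (measurable_bell_comp hg y)).aestronglyMeasurable _
    (ae_of_all _ fun ξ => abs_mul_bell_le hσ (g ξ) y)

lemma integrable_sub_sq_mul_bell [IsFiniteMeasure μ] (hσ : 0 < σ ^ 2) (hg : Measurable g)
    (c y : ℝ) : Integrable (fun ξ => (g ξ - c) ^ 2 * bell σ (g ξ) y) μ :=
  Integrable.of_bound
    (((hg.sub_const c).pow_const 2).mul (measurable_bell_comp hg y)).aestronglyMeasurable _
    (ae_of_all _ fun ξ => by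
      rw [Real.norm_of_nonneg (mul_nonneg (sq_nonneg _) (bell_pos _ _ _).le)]
      exact sub_sq_mul_bell_le hσ (g ξ) c y)

lemma evidence_pos [IsProbabilityMeasure μ] (hg : Measurable g) (y : ℝ) :
    0 < evidence μ σ g y :=
  integral_exp_pos (integrable_bell hg y)

lemma measurable_evidence [SFinite μ] (hg : Measurable g) : Measurable (evidence μ σ g) := by
  refine (StronglyMeasurable.integral_prod_right (f := fun y ξ => bell σ (g ξ) y) ?_).measurable
  exact ((measurable_bell σ).comp
    ((hg.comp measurable_snd).prodMk measurable_fst)).stronglyMeasurable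

lemma measurable_posteriorMean [SFinite μ] (hg : Measurable g) :
    Measurable (posteriorMean μ σ g) := by
  refine Measurable.div ?_ (measurable_evidence hg)
  refine (StronglyMeasurable.integral_prod_right
    (f := fun y ξ => g ξ * bell σ (g ξ) y) ?_).measurable
  exact ((hg.comp measurable_snd).mul ((measurable_bell σ).comp
    ((hg.comp measurable_snd).prodMk measurable_fst))).stronglyMeasurable

lemma posteriorMean_mul_evidence [IsProbabilityMeasure μ] (hg : Measurable g) (y : ℝ) :
    posteriorMean μ σ g y * evidence μ σ g y = ∫ ξ, g ξ * bell σ (g ξ) y ∂μ :=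
  div_mul_cancel₀ _ (evidence_pos hg y).ne'

/-- The posterior mean minimizes the mean square error, at every observation. -/
lemma integral_sub_sq_mul_bell [IsProbabilityMeasure μ] (hσ : 0 < σ ^ 2) (hg : Measurable g)
    (c y : ℝ) :
    ∫ ξ, (g ξ - c) ^ 2 * bell σ (g ξ) y ∂μ =
      (∫ ξ, (g ξ - posteriorMean μ σ g y) ^ 2 * bell σ (g ξ) y ∂μ) +
        evidence μ σ g y * (c - posteriorMean μ σ g y) ^ 2 := by
  set m := posteriorMean μ σ g y with hm
  have h1 : ∀ ξ, (g ξ - c) ^ 2 * bell σ (g ξ) y = (g ξ - m) ^ 2 * bell σ (g ξ) y +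
      (2 * (m - c) * (g ξ * bell σ (g ξ) y) + (c ^ 2 - m ^ 2) * bell σ (g ξ) y) := fun ξ => by ring
  simp_rw [h1]
  have i1 := integrable_sub_sq_mul_bell (μ := μ) hσ hg m y
  have i2 := (integrable_mul_bell (μ := μ) hσ hg y).const_mul (2 * (m - c))
  have i3 := (integrable_bell (μ := μ) (σ := σ) hg y).const_mul (c ^ 2 - m ^ 2)
  rw [integral_add i1 (by exact i2.add i3), integral_add i2 i3, integral_const_mul, integral_const_mul,
    ← posteriorMean_mul_evidence hg y, ← hm, ← evidence]
  ring

/-- Numerator and denominator have integrands bounded by constants independent of `n`, and the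
limiting denominator is positive. -/
lemma tendsto_posteriorMean [IsProbabilityMeasure μ] (hσ : 0 < σ ^ 2) {gs : ℕ → ℝ → ℝ}
    (hgs : ∀ n, Measurable (gs n)) (hg : Measurable g)
    (h : ∀ᵐ ξ ∂μ, Tendsto (fun n => gs n ξ) atTop (𝓝 (g ξ))) (y : ℝ) :
    Tendsto (fun n => posteriorMean μ σ (gs n) y) atTop (𝓝 (posteriorMean μ σ g y)) := by
  have hb : ∀ᵐ ξ ∂μ, Tendsto (fun n => bell σ (gs n ξ) y) atTop (𝓝 (bell σ (g ξ) y)) := by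
    filter_upwards [h] with ξ hξ
    have : Continuous fun b => bell σ b y := (continuous_bell σ).comp (Continuous.prodMk_left y)
    exact (this.tendsto _).comp hξ
  refine Tendsto.div ?_ ?_ (evidence_pos hg y).ne'
  · refine tendsto_integral_of_dominated_convergence (fun _ => 1 + (4 * σ ^ 2 + 2 * y ^ 2))
      (fun n => (integrable_mul_bell hσ (hgs n) y).aestronglyMeasurable) (integrable_const _)
      (fun n => ae_of_all _ fun ξ => abs_mul_bell_le hσ _ _) ?_
    filter_upwards [h, hb] with ξ h1 h2 using h1.mul h2
  · refine tendsto_integral_of_dominated_convergence (fun _ => 1)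
      (fun n => (integrable_bell (hgs n) y).aestronglyMeasurable) (integrable_const _)
      (fun n => ae_of_all _ fun ξ => ?_) hb
    rw [Real.norm_of_nonneg (bell_pos _ _ _).le]; exact bell_le_one _ _ _

/-- Some set `|g| ≤ n` carries at least half of the mass, and there `|y - g ξ| ≤ |y| + n`. Hence
`-log` of the evidence grows at most quadratically. -/
lemma evidence_lower_bound [IsProbabilityMeasure μ] (hσ : 0 < σ ^ 2) (hg : Measurable g) :
    ∃ R : ℝ, 0 ≤ R ∧ ∀ y, 1 / 2 * Real.exp (-(|y| + R) ^ 2 / (2 * σ ^ 2)) ≤ evidence μ σ g y := by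
  have hmono : Monotone fun n : ℕ => {ξ | |g ξ| ≤ n} := fun m n hmn ξ hξ =>
    le_trans (show |g ξ| ≤ m from hξ) (by exact_mod_cast hmn)
  have hU : ⋃ n : ℕ, {ξ | |g ξ| ≤ n} = Set.univ :=
    Set.eq_univ_of_forall fun ξ => Set.mem_iUnion.2 (exists_nat_ge |g ξ|)
  have ht := tendsto_measure_iUnion_atTop (μ := μ) hmono
  rw [hU, measure_univ] at ht
  obtain ⟨n, hn⟩ := (ht.eventually (lt_mem_nhds (show (1 / 2 : ℝ≥0∞) < 1 by
    simp [ENNReal.inv_lt_one]))).exists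
  refine ⟨n, by positivity, fun y => ?_⟩
  set S := {ξ | |g ξ| ≤ n}
  have hS : MeasurableSet S := measurableSet_le hg.abs measurable_const
  have hSr : 1 / 2 ≤ μ.real S := by
    have := (ENNReal.ofReal_le_iff_le_toReal (measure_ne_top μ S)).1
      (show ENNReal.ofReal (1 / 2) ≤ μ S by
        simpa [ENNReal.ofReal_div_of_pos] using hn.le)
    exact this
  calc 1 / 2 * Real.exp (-(|y| + n) ^ 2 / (2 * σ ^ 2))
      ≤ μ.real S * Real.exp (-(|y| + n) ^ 2 / (2 * σ ^ 2)) := by gcongr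
    _ = ∫ _ in S, Real.exp (-(|y| + n) ^ 2 / (2 * σ ^ 2)) ∂μ := by simp
    _ ≤ ∫ ξ in S, bell σ (g ξ) y ∂μ := by
        refine setIntegral_mono_on (integrable_const _).integrableOn
          (integrable_bell hg y).integrableOn hS fun ξ hξ => ?_
        have hξ' : |g ξ| ≤ n := hξ
        have h2 : |y - g ξ| ≤ |y| + n := (abs_sub _ _).trans (by gcongr)
        have h3 : (y - g ξ) ^ 2 ≤ (|y| + n) ^ 2 := by
          rw [← sq_abs (y - g ξ)]; gcongr
        unfold bell
        gcongr
    _ ≤ evidence μ σ g y :=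
        setIntegral_le_integral (integrable_bell hg y) (ae_of_all _ fun ξ => (bell_pos _ _ _).le)

/-- The posterior mean grows at most linearly. -/
lemma exists_abs_posteriorMean_le [IsProbabilityMeasure μ] (hσ : 0 < σ ^ 2) (hg : Measurable g) :
    ∃ C : ℝ, 0 ≤ C ∧ ∀ y, |posteriorMean μ σ g y| ≤ C * (1 + |y|) := by
  obtain ⟨R, hR, hD⟩ := evidence_lower_bound (μ := μ) hσ hg
  refine ⟨3 / 2 + 2 * σ ^ 2 + (1 + R) ^ 2 / 2, by positivity, fun y => ?_⟩
  have hpos := evidence_pos (μ := μ) (σ := σ) hg y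
  set D := evidence μ σ g y with hDdef
  set a := -Real.log D with ha
  have ha1 : a ≤ 1 + (|y| + R) ^ 2 / (2 * σ ^ 2) := by
    have h1 := Real.log_le_log (by positivity) (hD y)
    rw [Real.log_mul (by norm_num) (Real.exp_pos _).ne', Real.log_exp, one_div, Real.log_inv,
      neg_div] at h1
    have := Real.log_two_lt_d9
    linarith
  -- With `D = exp (-a)` this is `t - a + 1 ≤ exp (t - a)` multiplied by `exp (-t)`. Integrated, it
  -- bounds the posterior mean of `(y - g)²` by `2 σ² (a + 1)`, which is quadratic in `y`.
  have hpt : ∀ ξ, (y - g ξ) ^ 2 / (2 * σ ^ 2) * bell σ (g ξ) y ≤ a * bell σ (g ξ) y + D := by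
    intro ξ
    set t := (y - g ξ) ^ 2 / (2 * σ ^ 2) with ht
    have hb : bell σ (g ξ) y = Real.exp (-t) := by rw [bell, neg_div]
    have h1 := Real.add_one_le_exp (t - a)
    have h2 : D = Real.exp (-a) := by rw [ha, neg_neg, Real.exp_log hpos]
    rw [hb, h2]
    have h3 : Real.exp (-a) = Real.exp (t - a) * Real.exp (-t) := by
      rw [← Real.exp_add]; congr 1; ring
    rw [h3]
    nlinarith [Real.exp_pos (-t)]
  have hy : 0 < 1 + |y| := by positivity
  have hptg : ∀ ξ, |g ξ * bell σ (g ξ) y| ≤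
      (|y| + (1 + |y|) / 2 + σ ^ 2 * a / (1 + |y|)) * bell σ (g ξ) y + σ ^ 2 / (1 + |y|) * D := by
    intro ξ
    have hb := (bell_pos σ (g ξ) y)
    have h1 : |g ξ| ≤ |y| + |y - g ξ| := by
      have := abs_sub_abs_le_abs_sub (g ξ) y
      rw [abs_sub_comm] at this; linarith
    -- The weight `w = 1 + |y|` in `|z| ≤ w / 2 + z² / (2 w)` turns a quadratic bound on the second
    -- moment into a linear bound on the first.
    have h2 : |y - g ξ| ≤ (1 + |y|) / 2 + σ ^ 2 / (1 + |y|) * ((y - g ξ) ^ 2 / (2 * σ ^ 2)) := by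
      have : (1 + |y|) / 2 + σ ^ 2 / (1 + |y|) * ((y - g ξ) ^ 2 / (2 * σ ^ 2)) - |y - g ξ| =
          (1 + |y| - |y - g ξ|) ^ 2 / (2 * (1 + |y|)) := by
        have hs : σ ≠ 0 := fun h => by simp [h] at hσ
        rw [← sq_abs (y - g ξ)]
        field_simp
        ring
      have h3 : 0 ≤ (1 + |y| - |y - g ξ|) ^ 2 / (2 * (1 + |y|)) := by positivity
      linarith
    rw [abs_mul, abs_of_pos hb]
    calc |g ξ| * bell σ (g ξ) y
        ≤ (|y| + ((1 + |y|) / 2 + σ ^ 2 / (1 + |y|) * ((y - g ξ) ^ 2 / (2 * σ ^ 2)))) *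
          bell σ (g ξ) y := by gcongr; linarith
      _ = (|y| + (1 + |y|) / 2) * bell σ (g ξ) y + σ ^ 2 / (1 + |y|) *
          ((y - g ξ) ^ 2 / (2 * σ ^ 2) * bell σ (g ξ) y) := by ring
      _ ≤ (|y| + (1 + |y|) / 2) * bell σ (g ξ) y + σ ^ 2 / (1 + |y|) *
          (a * bell σ (g ξ) y + D) := by gcongr; exact hpt ξ
      _ = _ := by ring
  have hN : |∫ ξ, g ξ * bell σ (g ξ) y ∂μ| ≤
      (|y| + (1 + |y|) / 2 + σ ^ 2 * a / (1 + |y|)) * D + σ ^ 2 / (1 + |y|) * D := by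
    refine (abs_integral_le_integral_abs).trans ?_
    refine (integral_mono (integrable_mul_bell hσ hg y).abs
      (((integrable_bell hg y).const_mul _).add (integrable_const _)) hptg).trans ?_
    rw [Pi.add_def, integral_add ((integrable_bell hg y).const_mul _) (integrable_const _),
      integral_const_mul]
    simp [hDdef, evidence]
  rw [posteriorMean, abs_div, ← hDdef, abs_of_pos hpos, div_le_iff₀ hpos]
  refine hN.trans ?_
  rw [← add_mul]
  gcongr
  have h4 : σ ^ 2 * a / (1 + |y|) + σ ^ 2 / (1 + |y|) = σ ^ 2 * (a + 1) / (1 + |y|) := by ring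
  rw [add_assoc, h4]
  have h5 : |y| + R ≤ (1 + R) * (1 + |y|) := by nlinarith [abs_nonneg y, mul_nonneg hR (abs_nonneg y)]
  have h6 : (|y| + R) ^ 2 ≤ ((1 + R) * (1 + |y|)) ^ 2 := by gcongr
  have h7 : σ ^ 2 * (a + 1) / (1 + |y|) ≤ (2 * σ ^ 2 + (1 + R) ^ 2 / 2) * (1 + |y|) := by
    rw [div_le_iff₀ hy]
    calc σ ^ 2 * (a + 1) ≤ σ ^ 2 * (1 + (|y| + R) ^ 2 / (2 * σ ^ 2) + 1) := by gcongr
      _ = 2 * σ ^ 2 + (|y| + R) ^ 2 / 2 := by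
          have hs : σ ≠ 0 := fun h => by simp [h] at hσ
          field_simp
          ring
      _ ≤ 2 * σ ^ 2 * (1 + |y|) ^ 2 + ((1 + R) * (1 + |y|)) ^ 2 / 2 := by
          have : 1 ≤ (1 + |y|) ^ 2 := by nlinarith [abs_nonneg y]
          have := mul_le_mul_of_nonneg_left this (show 0 ≤ 2 * σ ^ 2 by positivity)
          linarith
      _ = _ := by ring
  nlinarith [abs_nonneg y]

end Posterior

/-! ### Helly's selection theorem -/

section Helly

/-- A countable power of `EReal` is compact and metrizable, hence sequentially compact; this
replaces the diagonal argument. -/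
lemma exists_subseq_tendsto_on_countable (f : ℕ → ℝ → EReal) {S : Set ℝ} (hS : S.Countable) :
    ∃ φ : ℕ → ℕ, StrictMono φ ∧ ∃ L : ℝ → EReal,
      ∀ x ∈ S, Tendsto (fun n => f (φ n) x) atTop (𝓝 (L x)) := by
  have := hS.to_subtype
  obtain ⟨a, φ, hφ, ha⟩ := CompactSpace.tendsto_subseq (fun n (x : S) => f n x)
  classical
  refine ⟨φ, hφ, fun x => if h : x ∈ S then a ⟨x, h⟩ else 0, fun x hx => ?_⟩
  simpa [hx] using (tendsto_pi_nhds.1 ha) ⟨x, hx⟩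

/-- **Helly's selection theorem** for monotone functions with extended real values. -/
theorem exists_subseq_tendsto_of_monotone (f : ℕ → ℝ → EReal) (hf : ∀ n, Monotone (f n)) :
    ∃ φ : ℕ → ℕ, StrictMono φ ∧ ∃ L : ℝ → EReal,
      ∀ x, Tendsto (fun n => f (φ n) x) atTop (𝓝 (L x)) := by
  obtain ⟨φ, hφ, L, hL⟩ := exists_subseq_tendsto_on_countable f
    (Set.countable_range ((↑) : ℚ → ℝ))
  have hL' : ∀ q : ℚ, Tendsto (fun n => f (φ n) q) atTop (𝓝 (L q)) := fun q =>
    hL q ⟨q, rfl⟩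
  -- The limit along the rationals, extended from the left. Where `U` is continuous, rationals on
  -- either side of `x` squeeze the sequence to `U x`; a second extraction handles the countably
  -- many other points.
  let U : ℝ → EReal := fun x => ⨆ q : {q : ℚ // (q : ℝ) < x}, L q
  have hU : Monotone U := fun x y hxy =>
    iSup_le fun q => le_iSup (fun q : {q : ℚ // (q : ℝ) < y} => L q) ⟨q, q.2.trans_le hxy⟩
  obtain ⟨ψ, hψ, M, hM⟩ := exists_subseq_tendsto_on_countable (fun n => f (φ n))
    hU.countable_not_continuousAt
  classical
  refine ⟨φ ∘ ψ, hφ.comp hψ, fun x => if ContinuousAt U x then U x else M x, fun x => ?_⟩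
  by_cases hx : ContinuousAt U x
  · simp only [hx, if_true]
    refine Tendsto.comp (f := ψ) (g := fun n => f (φ n) x) ?_ hψ.tendsto_atTop
    refine tendsto_order.2 ⟨fun a ha => ?_, fun a ha => ?_⟩
    · obtain ⟨⟨q, hq⟩, haq⟩ := lt_iSup_iff.1 ha
      filter_upwards [(hL' q).eventually (lt_mem_nhds haq)] with n hn
      exact hn.trans_le (hf _ hq.le)
    · have h1 : ∀ᶠ y in 𝓝[>] x, U y < a := nhdsWithin_le_nhds (hx.eventually (gt_mem_nhds ha))
      obtain ⟨y, hya, hxy⟩ := (h1.and self_mem_nhdsWithin).exists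
      obtain ⟨q, hq1, hq2⟩ := exists_rat_btwn (show x < y from hxy)
      have h2 : L q < a :=
        (le_iSup (fun q : {q : ℚ // (q : ℝ) < y} => L q) ⟨q, hq2⟩).trans_lt hya
      filter_upwards [(hL' q).eventually (gt_mem_nhds h2)] with n hn
      exact (hf _ hq1.le).trans_lt hn
  · simp only [hx, if_false]
    exact hM x hx

end Helly

/-! ### Integrals against Gaussian measures -/

section Density

variable {σ : ℝ}

lemma toNNReal_sq_ne_zero (hσ : 0 < σ ^ 2) : Real.toNNReal (σ ^ 2) ≠ 0 := by
  exact (Real.toNNReal_pos.2 hσ).ne'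

lemma gaussianPDFReal_eq_bell (σ b y : ℝ) :
    gaussianPDFReal b (Real.toNNReal (σ ^ 2)) y = bell σ b y / Real.sqrt (2 * Real.pi * σ ^ 2) := by
  rw [gaussianPDFReal, Real.coe_toNNReal _ (sq_nonneg σ), bell, inv_mul_eq_div]

lemma sqrt_two_pi_pos (hσ : 0 < σ ^ 2) : 0 < Real.sqrt (2 * Real.pi * σ ^ 2) := by
  have := Real.pi_pos
  positivity

lemma lintegral_gaussianReal (hσ : 0 < σ ^ 2) (b : ℝ) {f : ℝ → ℝ≥0∞} (hf : Measurable f) :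
    ∫⁻ y, f y ∂(gaussianReal b (Real.toNNReal (σ ^ 2))) =
      ∫⁻ y, ENNReal.ofReal (bell σ b y / Real.sqrt (2 * Real.pi * σ ^ 2)) * f y := by
  rw [gaussianReal_of_var_ne_zero _ (toNNReal_sq_ne_zero hσ),
    lintegral_withDensity_eq_lintegral_mul _ (measurable_gaussianPDF _ _) hf]
  simp [gaussianPDF, gaussianPDFReal_eq_bell]

lemma integrable_gaussianReal_iff (hσ : 0 < σ ^ 2) (b : ℝ) {f : ℝ → ℝ} :
    Integrable f (gaussianReal b (Real.toNNReal (σ ^ 2))) ↔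
      Integrable fun y => f y * (bell σ b y / Real.sqrt (2 * Real.pi * σ ^ 2)) := by
  rw [gaussianReal_of_var_ne_zero _ (toNNReal_sq_ne_zero hσ),
    integrable_withDensity_iff_integrable_smul' (measurable_gaussianPDF _ _)
      (ae_of_all _ fun _ => gaussianPDF_lt_top)]
  simp [toReal_gaussianPDF, gaussianPDFReal_eq_bell, mul_comm]

lemma integral_gaussianReal (hσ : 0 < σ ^ 2) (b : ℝ) (f : ℝ → ℝ) :
    ∫ y, f y ∂(gaussianReal b (Real.toNNReal (σ ^ 2))) =
      ∫ y, f y * (bell σ b y / Real.sqrt (2 * Real.pi * σ ^ 2)) := by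
  rw [integral_gaussianReal_eq_integral_smul (toNNReal_sq_ne_zero hσ)]
  simp [gaussianPDFReal_eq_bell, mul_comm]

lemma integrable_pow_gaussianReal (b : ℝ) (v : NNReal) (n : ℕ) :
    Integrable (fun y => (1 + |y|) ^ n) (gaussianReal b v) := by
  have h : MemLp (fun y : ℝ => 1 + |y|) n (gaussianReal b v) :=
    (memLp_const (1 : ℝ)).add (memLp_id_gaussianReal' (n : ℝ≥0∞) (ENNReal.natCast_ne_top n)).norm
  refine h.integrable_norm_pow'.congr (ae_of_all _ fun y => ?_)
  simp only
  rw [Real.norm_of_nonneg (by positivity)]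

lemma integrable_pow_mul_bell (hσ : 0 < σ ^ 2) (b : ℝ) (n : ℕ) :
    Integrable fun y => (1 + |y|) ^ n * bell σ b y := by
  have h := ((integrable_gaussianReal_iff hσ b).1
    (integrable_pow_gaussianReal b _ n)).mul_const (Real.sqrt (2 * Real.pi * σ ^ 2))
  refine h.congr (ae_of_all _ fun y => ?_)
  have := (sqrt_two_pi_pos hσ).ne'
  simp only
  field_simp

end Density

/-! ### The first controller's problem for a fixed second strategy -/

section BestResponse

variable {σ : ℝ} {h : ℝ → ℝ}

/-- The mean square error of the estimate `h`, when the state is `u`. -/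
noncomputable def missCost (σ : ℝ) (h : ℝ → ℝ) (u : ℝ) : ℝ :=
  ∫ y, (u - h y) ^ 2 * (bell σ u y / Real.sqrt (2 * Real.pi * σ ^ 2))

lemma missCost_nonneg (σ : ℝ) (h : ℝ → ℝ) (u : ℝ) : 0 ≤ missCost σ h u :=
  integral_nonneg fun _ => mul_nonneg (sq_nonneg _)
    (div_nonneg (bell_pos _ _ _).le (Real.sqrt_nonneg _))

lemma hasDerivAt_bell (σ u y : ℝ) :
    HasDerivAt (fun u => bell σ u y) ((y - u) / σ ^ 2 * bell σ u y) u := by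
  have h1 : HasDerivAt (fun u : ℝ => -(y - u) ^ 2 / (2 * σ ^ 2))
      ((y - u) / σ ^ 2) u := by
    have := ((((hasDerivAt_id u).const_sub y).pow 2).neg).div_const (2 * σ ^ 2)
    refine this.congr_deriv ?_
    simp only [id_eq, Nat.cast_ofNat, Nat.add_one_sub_one, pow_one]
    field_simp
  exact h1.exp.congr_deriv (mul_comm _ _)

/-- Since `(y - u₀)² ≤ 2 (y - u)² + 2`, doubling the variance absorbs a unit shift of the centre.
This dominates the kernel locally in `u`, for differentiation under the integral. -/
lemma bell_le_of_abs_sub_le_one (hσ : 0 < σ ^ 2) {u u₀ : ℝ} (hu : |u - u₀| ≤ 1) (y : ℝ) :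
    bell σ u y ≤ Real.exp (1 / (2 * σ ^ 2)) * bell (Real.sqrt 2 * σ) u₀ y := by
  rw [bell, bell, ← Real.exp_add, Real.exp_le_exp, mul_pow, Real.sq_sqrt (by norm_num)]
  have h1 : (u - u₀) ^ 2 ≤ 1 := by rw [← sq_abs]; nlinarith [abs_nonneg (u - u₀)]
  have h2 : (y - u₀) ^ 2 ≤ 2 * (y - u) ^ 2 + 2 := by nlinarith [sq_nonneg (y - u - (u - u₀))]
  have h3 : 1 / (2 * σ ^ 2) + -(y - u₀) ^ 2 / (2 * (2 * σ ^ 2)) - -(y - u) ^ 2 / (2 * σ ^ 2) =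
      (2 * (y - u) ^ 2 + 2 - (y - u₀) ^ 2) / (4 * σ ^ 2) := by
    have hs : σ ≠ 0 := fun h => by simp [h] at hσ
    field_simp
    ring
  have h4 : 0 ≤ (2 * (y - u) ^ 2 + 2 - (y - u₀) ^ 2) / (4 * σ ^ 2) :=
    div_nonneg (by linarith) (by positivity)
  linarith

lemma measurable_bell_right (σ u : ℝ) : Measurable (bell σ u) :=
  (measurable_bell σ).comp (measurable_const.prodMk measurable_id)

lemma measurable_kernel₁ (hh : Measurable h) (u : ℝ) : Measurable (kernel₁ σ h u) := by
  unfold kernel₁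
  fun_prop

lemma integrable_sub_sq_mul_density (hσ : 0 < σ ^ 2) (hh : Measurable h) {C : ℝ}
    (hb : ∀ y, |h y| ≤ C * (1 + |y|)) (u : ℝ) :
    Integrable fun y => (u - h y) ^ 2 * (bell σ u y / Real.sqrt (2 * Real.pi * σ ^ 2)) := by
  rw [← integrable_gaussianReal_iff hσ]
  refine ((integrable_pow_gaussianReal u _ 2).const_mul ((|u| + C) ^ 2)).mono'
    (by fun_prop) (ae_of_all _ fun y => ?_)
  rw [Real.norm_of_nonneg (sq_nonneg _), ← mul_pow, ← sq_abs]
  gcongr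
  refine (abs_sub _ _).trans ?_
  nlinarith [hb y, mul_nonneg (abs_nonneg u) (abs_nonneg y)]

/-- Differentiation under the integral: the two terms of `kernel₁` come from differentiating the
Gaussian factor and the squared error. -/
theorem integrable_kernel₁_and_hasDerivAt_missCost (hσ : 0 < σ ^ 2) (hh : Measurable h) {C : ℝ}
    (hC : 0 ≤ C) (hb : ∀ y, |h y| ≤ C * (1 + |y|)) (u₀ : ℝ) :
    Integrable (kernel₁ σ h u₀) ∧
      HasDerivAt (missCost σ h) (2 * ∫ y, kernel₁ σ h u₀ y) u₀ := by
  set A := |u₀| + 1 with hA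
  have hA1 : 1 ≤ A := by have := abs_nonneg u₀; linarith
  -- On the unit ball around `u₀`, `|y - u|` is at most `A (1 + |y|)` and `|u - h y|` at most `(A +
  -- C) (1 + |y|)`; `K` collects the resulting cubic bound.
  set K := A * (A + C) ^ 2 / (2 * σ ^ 2) + (A + C) with hK
  set s := Real.sqrt (2 * Real.pi * σ ^ 2) with hs
  have hs0 : 0 < s := sqrt_two_pi_pos hσ
  have key := hasDerivAt_integral_of_dominated_loc_of_deriv_le (μ := (volume : Measure ℝ))
    (𝕜 := ℝ) (F := fun u y => (u - h y) ^ 2 * (bell σ u y / s))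
    (F' := fun u y => 2 * kernel₁ σ h u y) (x₀ := u₀)
    (bound := fun y => 2 * (K * Real.exp (1 / (2 * σ ^ 2)) / s *
      ((1 + |y|) ^ 3 * bell (Real.sqrt 2 * σ) u₀ y)))
    (Metric.ball_mem_nhds u₀ one_pos)
    (Eventually.of_forall fun u =>
      (integrable_sub_sq_mul_density hσ hh hb u).aestronglyMeasurable)
    (integrable_sub_sq_mul_density hσ hh hb u₀)
    ((measurable_kernel₁ hh u₀).const_mul 2).aestronglyMeasurable
    (ae_of_all _ fun y u hu => ?_) ?_ (ae_of_all _ fun y u _ => ?_)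
  · obtain ⟨h1, h2⟩ := key
    rw [integral_const_mul] at h2
    refine ⟨?_, h2⟩
    simpa using h1.const_mul (1 / 2)
  · have hu1 : |u - u₀| ≤ 1 := (Metric.mem_ball.1 hu).le
    have huA : |u| ≤ A := by
      have := abs_sub_abs_le_abs_sub u u₀
      rw [hA]; linarith
    have hy := abs_nonneg y
    have b1 : |u - h y| ≤ (A + C) * (1 + |y|) := by
      refine (abs_sub _ _).trans ?_
      nlinarith [hb y]
    have b2 : |y - u| ≤ A * (1 + |y|) := by
      refine (abs_sub _ _).trans ?_
      nlinarith
    have b3 := bell_le_of_abs_sub_le_one hσ hu1 y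
    have b4 : |(y - u) * (u - h y) ^ 2 / (2 * σ ^ 2) + (u - h y)| ≤ K * (1 + |y|) ^ 3 := by
      calc |(y - u) * (u - h y) ^ 2 / (2 * σ ^ 2) + (u - h y)|
          ≤ |y - u| * |u - h y| ^ 2 / (2 * σ ^ 2) + |u - h y| := by
            refine (abs_add_le _ _).trans (le_of_eq ?_)
            rw [abs_div, abs_mul, abs_pow, abs_of_pos (show 0 < 2 * σ ^ 2 by positivity)]
        _ ≤ A * (1 + |y|) * ((A + C) * (1 + |y|)) ^ 2 / (2 * σ ^ 2) + (A + C) * (1 + |y|) := by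
            gcongr
        _ ≤ A * (1 + |y|) * ((A + C) * (1 + |y|)) ^ 2 / (2 * σ ^ 2) + (A + C) * (1 + |y|) ^ 3 := by
            gcongr
            exact le_self_pow₀ (by linarith) (by norm_num)
        _ = _ := by rw [hK]; ring
    have e : kernel₁ σ h u y =
        ((y - u) * (u - h y) ^ 2 / (2 * σ ^ 2) + (u - h y)) * (bell σ u y / s) := rfl
    rw [e, Real.norm_eq_abs, abs_mul, abs_mul, abs_two,
      abs_of_pos (div_pos (bell_pos σ u y) hs0)]
    have hbs := (div_pos (bell_pos σ u y) hs0).le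
    calc _ ≤ 2 * ((K * (1 + |y|) ^ 3) *
          (Real.exp (1 / (2 * σ ^ 2)) * bell (Real.sqrt 2 * σ) u₀ y / s)) := by gcongr
      _ = _ := by ring
  · refine (Integrable.const_mul ?_ _).const_mul 2
    refine integrable_pow_mul_bell ?_ u₀ 3
    rw [mul_pow, Real.sq_sqrt (by norm_num)]
    positivity
  · have h1 := (((hasDerivAt_id u).sub_const (h y)).pow 2).mul
      ((hasDerivAt_bell σ u y).div_const s)
    have e : kernel₁ σ h u y =
        ((y - u) * (u - h y) ^ 2 / (2 * σ ^ 2) + (u - h y)) * (bell σ u y / s) := rfl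
    refine h1.congr_deriv ?_
    rw [e]
    have hs' : σ ≠ 0 := fun h => by simp [h] at hσ
    simp only [id_eq, Nat.cast_ofNat, Pi.pow_apply]
    field_simp
    ring

lemma continuous_missCost (hσ : 0 < σ ^ 2) (hh : Measurable h) {C : ℝ}
    (hC : 0 ≤ C) (hb : ∀ y, |h y| ≤ C * (1 + |y|)) : Continuous (missCost σ h) :=
  continuous_iff_continuousAt.2 fun u =>
    (integrable_kernel₁_and_hasDerivAt_missCost hσ hh hC hb u).2.continuousAt

/-- The first controller has a best response to `h`, and it is monotone. -/
theorem exists_monotone_bestResponse {k : ℝ} (hk : 0 < k ^ 2) (hF : Continuous (missCost σ h)) :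
    ∃ b : ℝ → ℝ, Monotone b ∧ ∀ x u, k ^ 2 * (b x - x) ^ 2 + missCost σ h (b x) ≤
      k ^ 2 * (u - x) ^ 2 + missCost σ h u := by
  have hex : ∀ x, ∃ b, ∀ u, k ^ 2 * (b - x) ^ 2 + missCost σ h b ≤
      k ^ 2 * (u - x) ^ 2 + missCost σ h u := by
    intro x
    refine Continuous.exists_forall_le (by fun_prop) ?_
    refine tendsto_atTop_mono (f := fun u : ℝ => k ^ 2 * (2 * ‖u‖ - (2 * |x| + 1))) (fun u => ?_) ?_
    · have h1 := missCost_nonneg σ h u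
      have h2 : 2 * ‖u‖ - (2 * |x| + 1) ≤ (u - x) ^ 2 := by
        have h3 := abs_sub_abs_le_abs_sub u x
        rw [Real.norm_eq_abs]
        nlinarith [sq_nonneg (|u - x| - 1), sq_abs (u - x)]
      nlinarith
    · refine Tendsto.const_mul_atTop hk ?_
      exact tendsto_atTop_add_const_right _ _
        ((tendsto_norm_cocompact_atTop (E := ℝ)).const_mul_atTop two_pos)
  choose b hb using hex
  refine ⟨b, fun x x' hxx => ?_, hb⟩
  rcases hxx.eq_or_lt with rfl | hlt
  · exact le_rfl
  by_contra hcon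
  have hcon := not_le.1 hcon
  -- Exchanging the two minimizers and adding the inequalities cancels `missCost` and leaves `(x' -
  -- x) * (b x - b x') ≤ 0`.
  have h1 := hb x (b x')
  have h2 := hb x' (b x)
  have h3 : 0 < k ^ 2 * ((x' - x) * (b x - b x')) :=
    mul_pos hk (mul_pos (by linarith) (by linarith))
  nlinarith

end BestResponse

/-! ### The cost functional and its minimizers -/

/-- The Gaussian density with mean `b` and variance `σ ^ 2`. -/
noncomputable abbrev density (σ b y : ℝ) : ℝ := bell σ b y / Real.sqrt (2 * Real.pi * σ ^ 2)

/-- The payoff of the pair `(g, h)` in Witsenhausen's reformulation, as a double integral. -/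
noncomputable def cost (μ : Measure ℝ) (σ k : ℝ) (g h : ℝ → ℝ) : ℝ≥0∞ :=
  ∫⁻ x, (∫⁻ y, ENNReal.ofReal (density σ (g x) y) *
    ENNReal.ofReal (k ^ 2 * (g x - x) ^ 2 + (g x - h y) ^ 2)) ∂μ

section Cost

variable {μ : Measure ℝ} {σ k : ℝ} {g h : ℝ → ℝ}

lemma density_nonneg (σ b y : ℝ) : 0 ≤ density σ b y :=
  div_nonneg (bell_pos _ _ _).le (Real.sqrt_nonneg _)

lemma measurable_density_comp (hg : Measurable g) :
    Measurable fun p : ℝ × ℝ => density σ (g p.1) p.2 := by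
  unfold density bell
  fun_prop

lemma measurable_density_right (σ b : ℝ) : Measurable fun y => density σ b y :=
  (measurable_bell_right σ b).div_const _

lemma measurable_cost_integrand (hg : Measurable g) (hh : Measurable h) :
    Measurable fun p : ℝ × ℝ => ENNReal.ofReal (density σ (g p.1) p.2) *
      ENNReal.ofReal (k ^ 2 * (g p.1 - p.1) ^ 2 + (g p.1 - h p.2) ^ 2) := by
  refine (measurable_density_comp hg).ennreal_ofReal.mul (Measurable.ennreal_ofReal ?_)
  fun_prop

lemma lintegral_density (hσ : 0 < σ ^ 2) (b : ℝ) :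
    ∫⁻ y, ENNReal.ofReal (density σ b y) = 1 := by
  have := lintegral_gaussianReal hσ b (f := fun _ => 1) measurable_const
  simpa using this.symm

lemma lintegral_density_mul_add (hσ : 0 < σ ^ 2) {a : ℝ} (ha : 0 ≤ a)
    (u : ℝ) :
    ∫⁻ y, ENNReal.ofReal (density σ u y) * ENNReal.ofReal (a + (u - h y) ^ 2) =
      ENNReal.ofReal a + ∫⁻ y, ENNReal.ofReal ((u - h y) ^ 2 * density σ u y) := by
  have h1 : ∀ y, ENNReal.ofReal (density σ u y) * ENNReal.ofReal (a + (u - h y) ^ 2) =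
      ENNReal.ofReal (density σ u y) * ENNReal.ofReal a +
        ENNReal.ofReal ((u - h y) ^ 2 * density σ u y) := fun y => by
    rw [ENNReal.ofReal_add ha (sq_nonneg _), mul_add, ENNReal.ofReal_mul (sq_nonneg _),
      mul_comm (ENNReal.ofReal ((u - h y) ^ 2))]
  simp_rw [h1]
  rw [lintegral_add_left ((measurable_density_right σ u).ennreal_ofReal.mul_const _),
    lintegral_mul_const _ (measurable_density_right σ u).ennreal_ofReal,
    lintegral_density hσ, one_mul]

lemma cost_eq_add (hσ : 0 < σ ^ 2) (hg : Measurable g) :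
    cost μ σ k g h = ∫⁻ x, ENNReal.ofReal (k ^ 2 * (g x - x) ^ 2) ∂μ +
      ∫⁻ x, (∫⁻ y, ENNReal.ofReal ((g x - h y) ^ 2 * density σ (g x) y)) ∂μ := by
  unfold cost
  rw [lintegral_congr fun x => lintegral_density_mul_add hσ
    (mul_nonneg (sq_nonneg k) (sq_nonneg (g x - x))) (g x)]
  exact lintegral_add_left (by fun_prop) _

/-- Replacing `h` by the posterior mean decreases the cost by an explicit amount. -/
lemma cost_eq_cost_posteriorMean_add [IsProbabilityMeasure μ] (hσ : 0 < σ ^ 2) (hg : Measurable g)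
    (hh : Measurable h) :
    cost μ σ k g h = cost μ σ k g (posteriorMean μ σ g) +
      ∫⁻ y, ENNReal.ofReal (evidence μ σ g y * (h y - posteriorMean μ σ g y) ^ 2 /
        Real.sqrt (2 * Real.pi * σ ^ 2)) := by
  have hs := sqrt_two_pi_pos hσ
  set s := Real.sqrt (2 * Real.pi * σ ^ 2) with hsdef
  -- Integrating over the state first lets the square be completed at each observation `y`.
  have swap : ∀ h : ℝ → ℝ, Measurable h →
      ∫⁻ x, (∫⁻ y, ENNReal.ofReal ((g x - h y) ^ 2 * density σ (g x) y)) ∂μ =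
        ∫⁻ y, ENNReal.ofReal ((∫ ξ, (g ξ - h y) ^ 2 * bell σ (g ξ) y ∂μ) / s) := by
    intro h hh
    rw [lintegral_lintegral_swap]
    · refine lintegral_congr fun y => ?_
      rw [← integral_div, ofReal_integral_eq_lintegral_ofReal
        ((integrable_sub_sq_mul_bell hσ hg (h y) y).div_const s)
        (ae_of_all _ fun ξ => div_nonneg (mul_nonneg (sq_nonneg _) (bell_pos _ _ _).le) hs.le)]
      simp_rw [density, ← mul_div_assoc, ← hsdef]
    · refine (Measurable.ennreal_ofReal ?_).aemeasurable
      exact Measurable.mul (by fun_prop) (measurable_density_comp hg)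
  have hm : Measurable (posteriorMean μ σ g) := measurable_posteriorMean hg
  rw [cost_eq_add hσ hg, cost_eq_add hσ hg, add_assoc, swap h hh, swap _ hm,
    ← lintegral_add_right]
  · congr 1
    refine lintegral_congr fun y => ?_
    have he := evidence_pos (μ := μ) (σ := σ) hg y
    rw [integral_sub_sq_mul_bell hσ hg (h y) y, add_div, ENNReal.ofReal_add]
    · exact div_nonneg (integral_nonneg fun ξ => mul_nonneg (sq_nonneg _) (bell_pos _ _ _).le) hs.le
    · positivity
  · exact ((((measurable_evidence hg).mul ((hh.sub hm).pow_const 2))).div_const s).ennreal_ofReal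

lemma cost_posteriorMean_le [IsProbabilityMeasure μ] (hσ : 0 < σ ^ 2) (hg : Measurable g)
    (hh : Measurable h) : cost μ σ k g (posteriorMean μ σ g) ≤ cost μ σ k g h := by
  rw [cost_eq_cost_posteriorMean_add hσ hg hh]
  exact le_self_add

lemma cost_eq_lintegral_missCost (hσ : 0 < σ ^ 2) (hh : Measurable h) {C : ℝ}
    (hb : ∀ y, |h y| ≤ C * (1 + |y|)) :
    cost μ σ k g h = ∫⁻ x, ENNReal.ofReal (k ^ 2 * (g x - x) ^ 2 + missCost σ h (g x)) ∂μ := by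
  refine lintegral_congr fun x => ?_
  have h0 : 0 ≤ k ^ 2 * (g x - x) ^ 2 := mul_nonneg (sq_nonneg k) (sq_nonneg (g x - x))
  rw [lintegral_density_mul_add hσ h0, ENNReal.ofReal_add h0 (missCost_nonneg _ _ _), missCost,
    ofReal_integral_eq_lintegral_ofReal (integrable_sub_sq_mul_density hσ hh hb (g x))
    (ae_of_all _ fun y => mul_nonneg (sq_nonneg _) (density_nonneg _ _ _))]

/-- Every pair of strategies is improved by a monotone one followed by its posterior mean. -/
lemma exists_monotone_cost_le [IsProbabilityMeasure μ] (hσ : 0 < σ ^ 2) (hk : 0 < k ^ 2)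
    (hg : Measurable g) (hh : Measurable h) :
    ∃ b : ℝ → ℝ, Monotone b ∧ cost μ σ k b (posteriorMean μ σ b) ≤ cost μ σ k g h := by
  -- No growth of `h` is known, so `h` is first replaced by the posterior mean of `g`; only then
  -- does the best response `b` exist, and its own posterior mean lowers the cost again.
  obtain ⟨C, hC, hb⟩ := exists_abs_posteriorMean_le (μ := μ) hσ hg
  have hm : Measurable (posteriorMean μ σ g) := measurable_posteriorMean hg
  obtain ⟨b, hbm, hle⟩ := exists_monotone_bestResponse hk (continuous_missCost hσ hm hC hb)
  refine ⟨b, hbm, ((cost_posteriorMean_le hσ hbm.measurable hm).trans ?_).trans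
    (cost_posteriorMean_le hσ hg hh)⟩
  rw [cost_eq_lintegral_missCost hσ hm hb, cost_eq_lintegral_missCost hσ hm hb]
  exact lintegral_mono fun x => ENNReal.ofReal_le_ofReal (hle x (g x))

/-- Lower semicontinuity of the cost under almost everywhere convergence. -/
lemma cost_le_liminf [IsProbabilityMeasure μ] (hσ : 0 < σ ^ 2) {gs : ℕ → ℝ → ℝ}
    (hgs : ∀ n, Measurable (gs n)) (hg : Measurable g)
    (hlim : ∀ᵐ x ∂μ, Tendsto (fun n => gs n x) atTop (𝓝 (g x))) :
    cost μ σ k g (posteriorMean μ σ g) ≤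
      liminf (fun n => cost μ σ k (gs n) (posteriorMean μ σ (gs n))) atTop := by
  let F : ℕ → ℝ → ℝ → ℝ≥0∞ := fun n x y => ENNReal.ofReal (density σ (gs n x) y) *
    ENNReal.ofReal (k ^ 2 * (gs n x - x) ^ 2 + (gs n x - posteriorMean μ σ (gs n) y) ^ 2)
  have hmeas : ∀ n, Measurable (Function.uncurry (F n)) := fun n =>
    measurable_cost_integrand (σ := σ) (k := k) (hgs n) (measurable_posteriorMean (hgs n))
  change _ ≤ liminf (fun n => ∫⁻ x, (∫⁻ y, F n x y) ∂μ) atTop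
  -- Fatou's lemma is applied in `x` and then in `y`; the integrands converge, so the inner `liminf`
  -- is a limit.
  refine le_trans ?_ (lintegral_liminf_le fun n => (hmeas n).lintegral_prod_right')
  refine lintegral_mono_ae ?_
  filter_upwards [hlim] with x hx
  refine le_trans ?_ (lintegral_liminf_le (f := fun n => F n x) fun n => (hmeas n).of_uncurry_left)
  refine lintegral_mono fun y => le_of_eq ?_
  refine (Tendsto.liminf_eq ?_).symm
  have hp := tendsto_posteriorMean hσ hgs hg hlim y
  have hd : Continuous fun b => density σ b y :=
    ((continuous_bell σ).comp (Continuous.prodMk_left y)).div_const _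
  refine ENNReal.Tendsto.mul (ENNReal.tendsto_ofReal ((hd.tendsto _).comp hx))
    (Or.inr ENNReal.ofReal_ne_top) (ENNReal.tendsto_ofReal ?_) (Or.inr ENNReal.ofReal_ne_top)
  exact (((hx.sub_const x).pow 2).const_mul _).add ((hx.sub hp).pow 2)

lemma lintegral_ofReal_sub_sq_le_cost (hσ : 0 < σ ^ 2) (hg : Measurable g) :
    ∫⁻ x, ENNReal.ofReal (k ^ 2 * (g x - x) ^ 2) ∂μ ≤ cost μ σ k g h := by
  rw [cost_eq_add hσ hg]
  exact le_self_add

lemma tendsto_ofReal_mul_sub_sq_top (hk : 0 < k ^ 2) {u : ℕ → ℝ} (x : ℝ)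
    (hu : Tendsto (fun n => |u n|) atTop atTop) :
    Tendsto (fun n => ENNReal.ofReal (k ^ 2 * (u n - x) ^ 2)) atTop (𝓝 ⊤) := by
  refine ENNReal.tendsto_ofReal_nhds_top.2 (Tendsto.const_mul_atTop hk ?_)
  refine tendsto_atTop_mono (f := fun n => 2 * |u n| - (2 * |x| + 1)) (fun n => ?_) ?_
  · have h3 := abs_sub_abs_le_abs_sub (u n) x
    nlinarith [sq_nonneg (|u n - x| - 1), sq_abs (u n - x)]
  · exact tendsto_atTop_add_const_right _ _ (hu.const_mul_atTop two_pos)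

/-- The direct method, with compactness supplied by monotonicity of the best responses. -/
theorem exists_cost_minimizer [IsProbabilityMeasure μ] (hσ : 0 < σ ^ 2) (hk : 0 < k ^ 2)
    {m : ℝ≥0∞} (hm : m < ⊤) (hlb : ∀ g h, Measurable g → Measurable h → m ≤ cost μ σ k g h)
    (hseq : ∃ gs hs : ℕ → ℝ → ℝ, (∀ n, Measurable (gs n)) ∧ (∀ n, Measurable (hs n)) ∧
      Tendsto (fun n => cost μ σ k (gs n) (hs n)) atTop (𝓝 m)) :
    ∃ g : ℝ → ℝ, Measurable g ∧ cost μ σ k g (posteriorMean μ σ g) = m := by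
  obtain ⟨gs, hs, hgs, hhs, hlim⟩ := hseq
  choose b hbm hble using fun n =>
    exists_monotone_cost_le (μ := μ) hσ hk (hgs n) (hhs n)
  have hbmeas : ∀ n, Measurable (b n) := fun n => (hbm n).measurable
  have hblim : Tendsto (fun n => cost μ σ k (b n) (posteriorMean μ σ (b n))) atTop (𝓝 m) :=
    tendsto_of_tendsto_of_tendsto_of_le_of_le tendsto_const_nhds hlim
      (fun n => hlb _ _ (hbmeas n) (measurable_posteriorMean (hbmeas n))) hble
  obtain ⟨φ, hφ, L, hL⟩ := exists_subseq_tendsto_of_monotone (fun n x => (b n x : EReal))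
    fun n x y hxy => EReal.coe_le_coe_iff.2 (hbm n hxy)
  have hLm : Measurable L := measurable_of_tendsto_metrizable
    (fun n => measurable_coe_real_ereal.comp (hbmeas (φ n))) (tendsto_pi_nhds.2 hL)
  have hφlim := hblim.comp hφ.tendsto_atTop
  have hfin : ∀ᵐ x ∂μ,
      liminf (fun n => ENNReal.ofReal (k ^ 2 * (b (φ n) x - x) ^ 2)) atTop < ⊤ := by
    have hmeas : ∀ n, Measurable fun x => ENNReal.ofReal (k ^ 2 * (b (φ n) x - x) ^ 2) :=
      fun n => by have := hbmeas (φ n); fun_prop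
    refine ae_lt_top (Measurable.liminf hmeas) (ne_of_lt ?_)
    refine (lintegral_liminf_le hmeas).trans_lt (lt_of_le_of_lt ?_ hm)
    refine le_trans (liminf_le_liminf (Eventually.of_forall fun n => ?_)) hφlim.liminf_eq.le
    exact lintegral_ofReal_sub_sq_le_cost hσ (hbmeas _)
  -- An infinite limit at `x` would send the penalty to `⊤`, against `hfin`. The default value of
  -- `toReal` thus matters only on a null set.
  have hconv : ∀ᵐ x ∂μ, Tendsto (fun n => b (φ n) x) atTop (𝓝 (L x).toReal) := by
    filter_upwards [hfin] with x hx
    have hne : ¬ Tendsto (fun n => |b (φ n) x|) atTop atTop := fun h =>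
      hx.ne (tendsto_ofReal_mul_sub_sq_top hk x h).liminf_eq
    have htop : L x ≠ ⊤ := fun h => hne <| by
      have := hL x
      rw [h, EReal.tendsto_coe_nhds_top_iff] at this
      exact tendsto_abs_atTop_atTop.comp this
    have hbot : L x ≠ ⊥ := fun h => hne <| by
      have := hL x
      rw [h, EReal.tendsto_coe_nhds_bot_iff] at this
      exact tendsto_abs_atBot_atTop.comp this
    exact (EReal.tendsto_toReal htop hbot).comp (hL x)
  have hgm : Measurable fun x => (L x).toReal := measurable_ereal_toReal.comp hLm
  refine ⟨fun x => (L x).toReal, hgm, le_antisymm ?_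
    (hlb _ _ hgm (measurable_posteriorMean hgm))⟩
  exact (cost_le_liminf hσ (fun n => hbmeas (φ n)) hgm hconv).trans hφlim.liminf_eq.le

/-- The first order conditions satisfied by a minimizer of the cost. -/
theorem firstOrder_of_minimizer [IsProbabilityMeasure μ] (hσ : 0 < σ ^ 2) (hk : 0 < k ^ 2)
    (hg : Measurable g) (hh : Measurable h) (hfin : cost μ σ k g h ≠ ⊤)
    (hmin : ∀ g' h', Measurable g' → Measurable h' → cost μ σ k g h ≤ cost μ σ k g' h') :
    (∀ᵐ x ∂μ, Integrable (kernel₁ σ h (g x)) ∧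
      g x = x - 1 / k ^ 2 * ∫ ζ, kernel₁ σ h (g x) ζ) ∧
    ∀ᵐ y, h y = posteriorMean μ σ g y := by
  have hm : Measurable (posteriorMean μ σ g) := measurable_posteriorMean hg
  have hdec := cost_eq_cost_posteriorMean_add (μ := μ) (k := k) hσ hg hh
  have heq : cost μ σ k g (posteriorMean μ σ g) = cost μ σ k g h :=
    le_antisymm (cost_posteriorMean_le hσ hg hh) (hmin _ _ hg hm)
  have hae : ∀ᵐ y, h y = posteriorMean μ σ g y := by
    rw [heq] at hdec
    -- Finiteness of the cost permits cancellation, so the excess integral vanishes; positivity of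
    -- the evidence then forces equality almost everywhere.
    have hzero := (ENNReal.cancel_of_ne hfin).inj.1 (hdec.symm.trans (add_zero _).symm)
    rw [lintegral_eq_zero_iff] at hzero
    · filter_upwards [hzero] with y hy
      have he := evidence_pos (μ := μ) (σ := σ) hg y
      have hs := sqrt_two_pi_pos hσ
      by_contra hne
      have h2 : 0 < (h y - posteriorMean μ σ g y) ^ 2 := by
        have := sub_ne_zero.2 hne
        positivity
      have h3 := ENNReal.ofReal_eq_zero.1 hy
      have h4 : 0 < evidence μ σ g y * (h y - posteriorMean μ σ g y) ^ 2 /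
        Real.sqrt (2 * Real.pi * σ ^ 2) := by positivity
      linarith
    · exact (((measurable_evidence hg).mul ((hh.sub hm).pow_const 2)).div_const _).ennreal_ofReal
  refine ⟨?_, hae⟩
  obtain ⟨C, hC, hb⟩ := exists_abs_posteriorMean_le (μ := μ) hσ hg
  have hcont := continuous_missCost hσ hm hC hb
  obtain ⟨b, hbm, hle⟩ := exists_monotone_bestResponse hk hcont
  have hbmeas := hbm.measurable
  have hcle : cost μ σ k g (posteriorMean μ σ g) ≤ cost μ σ k b (posteriorMean μ σ g) :=
    heq.le.trans (hmin _ _ hbmeas hm)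
  have hfin' : cost μ σ k g (posteriorMean μ σ g) ≠ ⊤ := heq ▸ hfin
  rw [cost_eq_lintegral_missCost hσ hm hb] at hfin'
  rw [cost_eq_lintegral_missCost hσ hm hb, cost_eq_lintegral_missCost hσ hm hb] at hcle
  have hpt : ∀ x, ENNReal.ofReal (k ^ 2 * (b x - x) ^ 2 + missCost σ (posteriorMean μ σ g) (b x)) ≤
      ENNReal.ofReal (k ^ 2 * (g x - x) ^ 2 + missCost σ (posteriorMean μ σ g) (g x)) :=
    fun x => ENNReal.ofReal_le_ofReal (hle x (g x))
  have hmc := hcont.measurable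
  -- The integrand of `b` lies below that of `g` everywhere while its integral is no smaller, so
  -- they agree almost everywhere and `g x` is itself a minimizer.
  have hEq := ae_eq_of_ae_le_of_lintegral_le (ae_of_all μ hpt)
    (ne_top_of_le_ne_top hfin' (lintegral_mono hpt)) (by fun_prop) hcle
  filter_upwards [hEq] with x hx
  have hnn : ∀ u, 0 ≤ k ^ 2 * (u - x) ^ 2 + missCost σ (posteriorMean μ σ g) u := fun u =>
    add_nonneg (mul_nonneg (sq_nonneg k) (sq_nonneg _)) (missCost_nonneg _ _ _)
  rw [ENNReal.ofReal_eq_ofReal_iff (hnn _) (hnn _)] at hx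
  have hloc : IsLocalMin (fun u => k ^ 2 * (u - x) ^ 2 + missCost σ (posteriorMean μ σ g) u)
      (g x) := Eventually.of_forall fun u => hx.symm.le.trans (hle x u)
  obtain ⟨hi, hd⟩ := integrable_kernel₁_and_hasDerivAt_missCost hσ hm hC hb (g x)
  have hk_ae : kernel₁ σ (posteriorMean μ σ g) (g x) =ᵐ[volume] kernel₁ σ h (g x) := by
    filter_upwards [hae] with y hy
    simp [kernel₁, hy]
  refine ⟨hi.congr hk_ae, ?_⟩
  have hd2 := ((((hasDerivAt_id (g x)).sub_const x).pow 2).const_mul (k ^ 2)).add hd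
  have h0 := hloc.hasDerivAt_eq_zero hd2
  rw [← integral_congr_ae hk_ae]
  simp only [id_eq, Nat.cast_ofNat, Nat.add_one_sub_one, pow_one, mul_one] at h0
  rw [one_div, inv_mul_eq_div, eq_sub_iff_add_eq, ← eq_sub_iff_add_eq', div_eq_iff hk.ne']
  linarith

end Cost

/-! ### The probabilistic model -/

lemma Strategy.measurable_bar₁ (γ : Strategy) : Measurable γ.bar₁ :=
  measurable_id.add γ.measurable_γ₁

/-- An initial state and an independent centred Gaussian disturbance with variance `σ ^ 2`. -/
structure IsModel {Ω : Type*} [MeasurableSpace Ω] (P : Measure Ω) (x₀ v : Ω → ℝ) (σ : ℝ) :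
    Prop where
  measurable_x₀ : Measurable x₀
  measurable_v : Measurable v
  indep : IndepFun x₀ v P
  sq_pos : 0 < σ ^ 2
  law_v : P.map v = gaussianReal 0 (Real.toNNReal (σ ^ 2))

section Model

variable {Ω : Type*} [MeasurableSpace Ω] {P : Measure Ω}
  {x₀ v : Ω → ℝ} {σ : ℝ}

namespace IsModel

lemma measurable_obs (M : IsModel P x₀ v σ) (γ : Strategy) : Measurable (obs x₀ v γ) :=
  (γ.measurable_bar₁.comp M.measurable_x₀).add M.measurable_v

lemma measurable_pair (M : IsModel P x₀ v σ) (γ : Strategy) :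
    Measurable fun ω => (x₀ ω, obs x₀ v γ ω) :=
  M.measurable_x₀.prodMk (M.measurable_obs γ)

lemma channel_eq (M : IsModel P x₀ v σ) (x u : ℝ) :
    channel P v x u = gaussianReal (x + u) (Real.toNNReal (σ ^ 2)) := by
  have h : channel P v x u = (P.map v).map fun z => x + u + z := by
    rw [Measure.map_map (by fun_prop) M.measurable_v]; rfl
  rw [h, M.law_v, gaussianReal_map_const_add, zero_add]

lemma ofReal_density_zero_mul_gaussianRatio (M : IsModel P x₀ v σ) (x u y : ℝ) :
    ENNReal.ofReal (density σ 0 y) * ENNReal.ofReal (gaussianRatio σ x u y) =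
      ENNReal.ofReal (density σ (x + u) y) := by
  rw [← ENNReal.ofReal_mul (density_nonneg _ _ _)]
  congr 1
  have := (Real.exp_pos (-y ^ 2 / (2 * σ ^ 2))).ne'
  have := (sqrt_two_pi_pos M.sq_pos).ne'
  rw [density, density, gaussianRatio, bell, bell, sub_zero, ← sub_sub]
  field_simp

lemma measurable_gaussianRatio_strategy (γ : Strategy) :
    Measurable fun z : ℝ × ℝ => gaussianRatio σ z.1 (γ.γ₁ z.1) z.2 := by
  have := γ.measurable_γ₁
  unfold gaussianRatio
  fun_prop

lemma integrable_pow_v (M : IsModel P x₀ v σ) (n : ℕ) :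
    Integrable (fun ω => (1 + |v ω|) ^ n) P := by
  have h := integrable_pow_gaussianReal 0 (Real.toNNReal (σ ^ 2)) n
  rw [← M.law_v] at h
  exact (integrable_map_measure (by fun_prop) M.measurable_v.aemeasurable).1 h

lemma channel_eq_withDensity (M : IsModel P x₀ v σ) (x u : ℝ) :
    channel P v x u =
      (P.map v).withDensity fun y => ENNReal.ofReal (gaussianRatio σ x u y) := by
  have hm : Measurable fun y => gaussianRatio σ x u y := by
    unfold gaussianRatio
    fun_prop
  refine Measure.ext_of_lintegral _ fun f hf => ?_
  rw [lintegral_withDensity_eq_lintegral_mul _ hm.ennreal_ofReal hf, M.law_v, M.channel_eq,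
    lintegral_gaussianReal M.sq_pos _ hf,
    lintegral_gaussianReal M.sq_pos _ (hm.ennreal_ofReal.mul hf)]
  refine lintegral_congr fun y => ?_
  rw [Pi.mul_apply, ← mul_assoc, M.ofReal_density_zero_mul_gaussianRatio]

variable [IsProbabilityMeasure P]

lemma isProbabilityMeasure_map (M : IsModel P x₀ v σ) : IsProbabilityMeasure (P.map x₀) :=
  Measure.isProbabilityMeasure_map M.measurable_x₀.aemeasurable

lemma map_prod (M : IsModel P x₀ v σ) :
    P.map (fun ω => (x₀ ω, v ω)) =
      (P.map x₀).prod (gaussianReal 0 (Real.toNNReal (σ ^ 2))) := by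
  rw [← M.law_v]
  exact (indepFun_iff_map_prod_eq_prod_map_map M.measurable_x₀.aemeasurable
    M.measurable_v.aemeasurable).1 M.indep

/-- Independence makes the law of `(x₀, v)` a product, and for fixed `x` the observation is the
noise translated by `γ.bar₁ x`. -/
lemma lintegral_obs (M : IsModel P x₀ v σ) (γ : Strategy) {f : ℝ × ℝ → ℝ≥0∞}
    (hf : Measurable f) :
    ∫⁻ ω, f (x₀ ω, obs x₀ v γ ω) ∂P = ∫⁻ x, (∫⁻ y,
      ENNReal.ofReal (density σ (γ.bar₁ x) y) * f (x, y)) ∂(P.map x₀) := by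
  have hbar := γ.measurable_bar₁
  have h1 : Measurable fun p : ℝ × ℝ => f (p.1, γ.bar₁ p.1 + p.2) := by fun_prop
  have h2 : ∫⁻ ω, f (x₀ ω, obs x₀ v γ ω) ∂P =
      ∫⁻ p, f (p.1, γ.bar₁ p.1 + p.2) ∂(P.map (fun ω => (x₀ ω, v ω))) :=
    (lintegral_map h1 (M.measurable_x₀.prodMk M.measurable_v)).symm
  rw [h2, M.map_prod, lintegral_prod _ h1.aemeasurable]
  refine lintegral_congr fun x => ?_
  have hfx : Measurable fun y => f (x, y) := hf.comp measurable_prodMk_left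
  rw [← lintegral_gaussianReal M.sq_pos (γ.bar₁ x) hfx]
  have := gaussianReal_map_const_add (μ := 0) (v := Real.toNNReal (σ ^ 2)) (γ.bar₁ x)
  rw [zero_add] at this
  rw [← this, lintegral_map hfx (by fun_prop)]

lemma payoff_eq_cost (M : IsModel P x₀ v σ) (k : ℝ) (γ : Strategy) :
    payoff P x₀ v k γ = cost (P.map x₀) σ k γ.bar₁ γ.γ₂ := by
  have h1 := γ.measurable_bar₁
  have h2 := γ.measurable_γ₂
  have h : Measurable fun p : ℝ × ℝ =>
      ENNReal.ofReal (k ^ 2 * (γ.bar₁ p.1 - p.1) ^ 2 + (γ.bar₁ p.1 - γ.γ₂ p.2) ^ 2) := by fun_prop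
  rw [cost, ← M.lintegral_obs γ h, payoff]
  refine lintegral_congr fun ω => ?_
  simp only [Strategy.bar₁, state₂, state₁, add_sub_cancel_left]

/-! ### Change of measure -/

lemma originalLaw_eq_withDensity (M : IsModel P x₀ v σ) (γ : Strategy) :
    originalLaw P x₀ v γ = (referenceLaw P x₀ v).withDensity
      fun z => ENNReal.ofReal (gaussianRatio σ z.1 (γ.γ₁ z.1) z.2) := by
  have hm := (measurable_gaussianRatio_strategy (σ := σ) γ).ennreal_ofReal
  refine Measure.ext_of_lintegral _ fun f hf => ?_
  rw [originalLaw, lintegral_map hf (M.measurable_pair γ), M.lintegral_obs γ hf,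
    lintegral_withDensity_eq_lintegral_mul _ hm hf, referenceLaw, M.law_v,
    lintegral_prod _ (hm.mul hf).aemeasurable]
  refine lintegral_congr fun x => ?_
  have hx : Measurable fun y => ((fun z : ℝ × ℝ =>
      ENNReal.ofReal (gaussianRatio σ z.1 (γ.γ₁ z.1) z.2)) * f) (x, y) :=
    (hm.mul hf).comp measurable_prodMk_left
  rw [lintegral_gaussianReal M.sq_pos 0 hx]
  refine lintegral_congr fun y => ?_
  rw [Pi.mul_apply, ← mul_assoc, M.ofReal_density_zero_mul_gaussianRatio]
  rfl

/-- The Lebesgue reference measure serves for comparing null sets and for Bayes' formula. -/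
lemma originalLaw_eq_withDensity_volume (M : IsModel P x₀ v σ) (γ : Strategy) :
    originalLaw P x₀ v γ = ((P.map x₀).prod volume).withDensity
      fun z => ENNReal.ofReal (density σ (γ.bar₁ z.1) z.2) := by
  have hm := (measurable_density_comp (σ := σ) γ.measurable_bar₁).ennreal_ofReal
  refine Measure.ext_of_lintegral _ fun f hf => ?_
  rw [originalLaw, lintegral_map hf (M.measurable_pair γ), M.lintegral_obs γ hf,
    lintegral_withDensity_eq_lintegral_mul _ hm hf, lintegral_prod _ (hm.mul hf).aemeasurable]
  rfl

theorem changeOfMeasure (M : IsModel P x₀ v σ) :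
    (∀ x u y : ℝ, 0 < gaussianRatio σ x u y) ∧
      (∀ x u : ℝ, channel P v x u ≪ P.map v ∧
        (channel P v x u).rnDeriv (P.map v) =ᵐ[P.map v]
          fun y => ENNReal.ofReal (gaussianRatio σ x u y)) ∧
      (∀ γ : Strategy,
        originalLaw P x₀ v γ ≪ referenceLaw P x₀ v ∧
        (originalLaw P x₀ v γ).rnDeriv (referenceLaw P x₀ v)
          =ᵐ[referenceLaw P x₀ v]
          fun z => ENNReal.ofReal (gaussianRatio σ z.1 (γ.γ₁ z.1) z.2)) := by
  have := M.isProbabilityMeasure_map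
  have : IsProbabilityMeasure (P.map v) :=
    Measure.isProbabilityMeasure_map M.measurable_v.aemeasurable
  have : IsProbabilityMeasure (referenceLaw P x₀ v) := by unfold referenceLaw; infer_instance
  refine ⟨fun x u y => div_pos (Real.exp_pos _) (Real.exp_pos _), fun x u => ?_, fun γ => ?_⟩
  · have hm : Measurable fun y => gaussianRatio σ x u y := by
      unfold gaussianRatio
      fun_prop
    rw [M.channel_eq_withDensity]
    exact ⟨withDensity_absolutelyContinuous _ _, Measure.rnDeriv_withDensity _ hm.ennreal_ofReal⟩
  · rw [M.originalLaw_eq_withDensity]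
    exact ⟨withDensity_absolutelyContinuous _ _, Measure.rnDeriv_withDensity _
      (measurable_gaussianRatio_strategy γ).ennreal_ofReal⟩

/-! ### Conditional expectations -/

/-- The observation and Lebesgue measure have the same null sets. -/
lemma ae_obs_iff (M : IsModel P x₀ v σ) (γ : Strategy) {p : ℝ → Prop}
    (hp : MeasurableSet {y | p y}) : (∀ᵐ ω ∂P, p (obs x₀ v γ ω)) ↔ ∀ᵐ y, p y := by
  have := M.isProbabilityMeasure_map
  have hm := (measurable_density_comp (σ := σ) γ.measurable_bar₁).ennreal_ofReal
  have hp2 : MeasurableSet {z : ℝ × ℝ | p z.2} := measurable_snd hp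
  have h1 : (∀ᵐ ω ∂P, p (obs x₀ v γ ω)) ↔ ∀ᵐ z ∂(originalLaw P x₀ v γ), p z.2 :=
    (ae_map_iff (M.measurable_pair γ).aemeasurable hp2).symm
  have h2 : (∀ᵐ z ∂((P.map x₀).prod (volume : Measure ℝ)), p z.2) ↔ ∀ᵐ y, p y := by
    have := ae_map_iff (μ := (P.map x₀).prod (volume : Measure ℝ)) measurable_snd.aemeasurable hp
    rw [measurePreserving_snd.map_eq] at this
    exact this.symm
  rw [h1, M.originalLaw_eq_withDensity_volume, ae_withDensity_iff hm, ← h2]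
  refine eventually_congr (ae_of_all _ fun z => ?_)
  have : ENNReal.ofReal (density σ (γ.bar₁ z.1) z.2) ≠ 0 := by
    rw [Ne, ENNReal.ofReal_eq_zero, not_le]
    exact div_pos (bell_pos _ _ _) (sqrt_two_pi_pos M.sq_pos)
  simp [this]

/-- Conditional expectations given the initial state are integrals over the observation. -/
lemma condExp_x₀ (M : IsModel P x₀ v σ) (γ : Strategy) {F : ℝ → ℝ → ℝ}
    (hF : Measurable (Function.uncurry F))
    (hint : Integrable (fun ω => F (x₀ ω) (obs x₀ v γ ω)) P) :
    (∀ᵐ x ∂(P.map x₀), Integrable (F x) (gaussianReal (γ.bar₁ x) (Real.toNNReal (σ ^ 2)))) ∧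
    Measurable (fun x => ∫ y, F x y ∂(gaussianReal (γ.bar₁ x) (Real.toNNReal (σ ^ 2)))) ∧
    P[fun ω => F (x₀ ω) (obs x₀ v γ ω) | MeasurableSpace.comap x₀ inferInstance] =ᵐ[P]
      fun ω => ∫ y, F (x₀ ω) y ∂(gaussianReal (γ.bar₁ (x₀ ω)) (Real.toNNReal (σ ^ 2))) := by
  have hpx := M.isProbabilityMeasure_map
  set N := gaussianReal 0 (Real.toNNReal (σ ^ 2)) with hN
  have hbar := γ.measurable_bar₁
  let G : ℝ × ℝ → ℝ := fun p => F p.1 (γ.bar₁ p.1 + p.2)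
  have hG : Measurable G := hF.comp (measurable_fst.prodMk ((hbar.comp measurable_fst).add
    measurable_snd))
  have hpair : Measurable fun ω => (x₀ ω, v ω) := M.measurable_x₀.prodMk M.measurable_v
  have hmap : ∀ x, gaussianReal (γ.bar₁ x) (Real.toNNReal (σ ^ 2)) =
      N.map fun z => γ.bar₁ x + z := fun x => by
    rw [hN, gaussianReal_map_const_add, zero_add]
  have hFx : ∀ x, Measurable (F x) := fun x => hF.of_uncurry_left
  have hint_eq : ∀ x, ∫ y, F x y ∂(gaussianReal (γ.bar₁ x) (Real.toNNReal (σ ^ 2))) =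
      ∫ z, G (x, z) ∂N := fun x => by
    rw [hmap, integral_map (by fun_prop) (hFx x).aestronglyMeasurable]
  have hGint : Integrable G ((P.map x₀).prod N) := by
    rw [← M.map_prod, integrable_map_measure hG.aestronglyMeasurable hpair.aemeasurable]
    exact hint
  refine ⟨?_, ?_, ?_⟩
  · filter_upwards [hGint.prod_right_ae] with x hx
    rw [hmap, integrable_map_measure (hFx x).aestronglyMeasurable (by fun_prop)]
    exact hx
  · simp_rw [hint_eq]
    exact (hG.stronglyMeasurable.integral_prod_right (ν := N)).measurable
  -- By independence the noise keeps its law when conditioned on `x₀`.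
  · have hcd : condDistrib v x₀ P =ᵐ[P.map x₀] Kernel.const ℝ N :=
      condDistrib_ae_eq_of_measure_eq_compProd x₀ M.measurable_v.aemeasurable
        (by rw [Measure.compProd_const, M.map_prod])
    have h := condExp_prod_ae_eq_integral_condDistrib (μ := P) (f := G) M.measurable_x₀
      M.measurable_v.aemeasurable hG.stronglyMeasurable hint
    filter_upwards [h, ae_of_ae_map M.measurable_x₀.aemeasurable hcd] with ω h1 h2
    rw [hint_eq]
    refine Eq.trans h1 ?_
    rw [h2, Kernel.const_apply]

lemma integral_obs (M : IsModel P x₀ v σ) (γ : Strategy) {F : ℝ → ℝ → ℝ}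
    (hF : Measurable (Function.uncurry F))
    (hint : Integrable (fun ω => F (x₀ ω) (obs x₀ v γ ω)) P) :
    ∫ ω, F (x₀ ω) (obs x₀ v γ ω) ∂P =
      ∫ y, ∫ x, F x y * density σ (γ.bar₁ x) y ∂(P.map x₀) := by
  have := M.isProbabilityMeasure_map
  have hm := (measurable_density_comp (σ := σ) γ.measurable_bar₁).ennreal_ofReal
  have h1 : Integrable (Function.uncurry F) (originalLaw P x₀ v γ) :=
    (integrable_map_measure hF.aestronglyMeasurable (M.measurable_pair γ).aemeasurable).2 hint
  have h2 : ∫ ω, F (x₀ ω) (obs x₀ v γ ω) ∂P =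
      ∫ z, Function.uncurry F z ∂(originalLaw P x₀ v γ) :=
    (integral_map (M.measurable_pair γ).aemeasurable hF.aestronglyMeasurable).symm
  rw [M.originalLaw_eq_withDensity_volume] at h1 h2
  rw [integrable_withDensity_iff_integrable_smul' hm (ae_of_all _ fun _ => ENNReal.ofReal_lt_top)]
    at h1
  rw [h2, integral_withDensity_eq_integral_toReal_smul hm
    (ae_of_all _ fun _ => ENNReal.ofReal_lt_top), integral_prod_symm _ h1]
  simp only [ENNReal.toReal_ofReal (density_nonneg _ _ _), Function.uncurry, smul_eq_mul, mul_comm]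

/-- Conditional expectations of the state given the observation are posterior means. -/
lemma condExp_obs (M : IsModel P x₀ v σ) (γ : Strategy)
    (hint : Integrable (fun ω => γ.bar₁ (x₀ ω)) P) :
    P[fun ω => γ.bar₁ (x₀ ω) | MeasurableSpace.comap (obs x₀ v γ) inferInstance] =ᵐ[P]
      fun ω => posteriorMean (P.map x₀) σ γ.bar₁ (obs x₀ v γ ω) := by
  have := M.isProbabilityMeasure_map
  have hbar := γ.measurable_bar₁
  have hobs := M.measurable_obs γ
  set m := posteriorMean (P.map x₀) σ γ.bar₁ with hm
  have hmm : Measurable m := measurable_posteriorMean hbar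
  obtain ⟨C, hC, hb⟩ := exists_abs_posteriorMean_le (μ := P.map x₀) M.sq_pos hbar
  have hmint : Integrable (fun ω => m (obs x₀ v γ ω)) P := by
    refine ((hint.abs.add (M.integrable_pow_v 1)).const_mul C).mono'
      (hmm.comp hobs).aestronglyMeasurable (ae_of_all _ fun ω => ?_)
    refine (hb _).trans ?_
    have h1 : |obs x₀ v γ ω| ≤ |γ.bar₁ (x₀ ω)| + |v ω| := abs_add_le _ _
    simp only [Pi.add_apply, pow_one]
    exact mul_le_mul_of_nonneg_left (by linarith) hC
  -- On each event `obs ∈ B` both sides become integrals over `y`, where they agree because the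
  -- posterior mean times the evidence is `∫ g * bell`.
  refine (ae_eq_condExp_of_forall_setIntegral_eq hobs.comap_le hint
    (fun s _ _ => hmint.integrableOn) (fun s hs _ => ?_) ?_).symm
  · obtain ⟨B, hB, rfl⟩ := hs
    have hS : MeasurableSet (obs x₀ v γ ⁻¹' B) := hobs hB
    rw [← integral_indicator hS, ← integral_indicator hS]
    have hBm : Measurable (B.indicator (1 : ℝ → ℝ)) := measurable_one.indicator hB
    have e : ∀ (f : ℝ → ℝ → ℝ), (obs x₀ v γ ⁻¹' B).indicator
        (fun ω => f (x₀ ω) (obs x₀ v γ ω)) =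
        fun ω => B.indicator (1 : ℝ → ℝ) (obs x₀ v γ ω) * f (x₀ ω) (obs x₀ v γ ω) := fun f => by
      ext ω
      by_cases h : obs x₀ v γ ω ∈ B <;> simp [h]
    have i1 := hmint.indicator hS
    have i2 := hint.indicator hS
    rw [e fun _ y => m y] at i1 ⊢
    rw [e fun x _ => γ.bar₁ x] at i2 ⊢
    rw [M.integral_obs γ (F := fun _ y => B.indicator (1 : ℝ → ℝ) y * m y)
      ((hBm.comp measurable_snd).mul (hmm.comp measurable_snd)) i1,
      M.integral_obs γ (F := fun x y => B.indicator (1 : ℝ → ℝ) y * γ.bar₁ x)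
      ((hBm.comp measurable_snd).mul (hbar.comp measurable_fst)) i2]
    refine integral_congr_ae (ae_of_all _ fun y => ?_)
    have h1 := posteriorMean_mul_evidence (μ := P.map x₀) (σ := σ) hbar y
    simp only [density, ← mul_div_assoc, mul_assoc, integral_div, integral_const_mul]
    rw [← h1, ← hm, evidence]
  · exact (hmm.comp (comap_measurable _)).aestronglyMeasurable

end IsModel
end Model

/-! ### Equivalence of the systems of equations -/

/-- The stationarity bracket, with the terms that do not depend on `γ₂` separated. -/
lemma bracket_eq {Ω : Type*} {x₀ v : Ω → ℝ} {k σ : ℝ} (γ : Strategy) (ω : Ω) :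
    bracket k σ γ.γ₂ (x₀ ω) (γ.γ₁ (x₀ ω)) (obs x₀ v γ ω) =
      (k ^ 2 / σ ^ 2 * ((obs x₀ v γ ω - γ.bar₁ (x₀ ω)) * γ.γ₁ (x₀ ω) ^ 2) +
        2 * k ^ 2 * γ.γ₁ (x₀ ω)) +
      (1 / σ ^ 2 * ((obs x₀ v γ ω - γ.bar₁ (x₀ ω)) *
        (γ.bar₁ (x₀ ω) - γ.γ₂ (obs x₀ v γ ω)) ^ 2) +
        2 * (γ.bar₁ (x₀ ω) - γ.γ₂ (obs x₀ v γ ω))) := by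
  simp only [bracket, Strategy.bar₁]
  ring

lemma cubic_eq {Ω : Type*} {x₀ v : Ω → ℝ} (γ : Strategy) : (fun ω => (obs x₀ v γ ω - x₀ ω - γ.γ₁ (x₀ ω)) *
    (x₀ ω + γ.γ₁ (x₀ ω) - γ.γ₂ (obs x₀ v γ ω)) ^ 2) =
    fun ω => (obs x₀ v γ ω - γ.bar₁ (x₀ ω)) *
      (γ.bar₁ (x₀ ω) - γ.γ₂ (obs x₀ v γ ω)) ^ 2 := by
  funext ω
  rw [sub_sub, Strategy.bar₁]

section Equations

variable {Ω : Type*} [MeasurableSpace Ω] {P : Measure Ω}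
  {x₀ v : Ω → ℝ} {k σ : ℝ}

namespace IsModel

lemma memLp_of_payoff_lt_top (M : IsModel P x₀ v σ) (hk : 0 < k ^ 2) {γ : Strategy}
    (hfin : payoff P x₀ v k γ < ⊤) :
    MemLp (fun ω => γ.γ₁ (x₀ ω)) 2 P ∧
      MemLp (fun ω => γ.bar₁ (x₀ ω) - γ.γ₂ (obs x₀ v γ ω)) 2 P := by
  have m1 : Measurable fun ω => γ.γ₁ (x₀ ω) := γ.measurable_γ₁.comp M.measurable_x₀
  have m2 : Measurable fun ω => γ.bar₁ (x₀ ω) - γ.γ₂ (obs x₀ v γ ω) :=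
    (γ.measurable_bar₁.comp M.measurable_x₀).sub (γ.measurable_γ₂.comp (M.measurable_obs γ))
  have hint : Integrable (fun ω => k ^ 2 * γ.γ₁ (x₀ ω) ^ 2 +
      (γ.bar₁ (x₀ ω) - γ.γ₂ (obs x₀ v γ ω)) ^ 2) P := by
    refine ⟨((m1.pow_const 2).const_mul _ |>.add (m2.pow_const 2)).aestronglyMeasurable, ?_⟩
    rw [hasFiniteIntegral_iff_ofReal (ae_of_all _ fun ω => by positivity)]
    exact hfin
  constructor
  · rw [memLp_two_iff_integrable_sq m1.aestronglyMeasurable]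
    refine (hint.const_mul (1 / k ^ 2)).mono' (m1.pow_const 2).aestronglyMeasurable
      (ae_of_all _ fun ω => ?_)
    rw [Real.norm_of_nonneg (sq_nonneg _), one_div, inv_mul_eq_div, le_div_iff₀ hk]
    nlinarith [sq_nonneg (γ.bar₁ (x₀ ω) - γ.γ₂ (obs x₀ v γ ω))]
  · rw [memLp_two_iff_integrable_sq m2.aestronglyMeasurable]
    refine hint.mono' (m2.pow_const 2).aestronglyMeasurable (ae_of_all _ fun ω => ?_)
    rw [Real.norm_of_nonneg (sq_nonneg _)]
    nlinarith [sq_nonneg (γ.γ₁ (x₀ ω))]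

lemma memLp_bar₁ (M : IsModel P x₀ v σ) (hx : MemLp x₀ 2 P) (hk : 0 < k ^ 2) {γ : Strategy}
    (hfin : payoff P x₀ v k γ < ⊤) : MemLp (fun ω => γ.bar₁ (x₀ ω)) 2 P :=
  hx.add (M.memLp_of_payoff_lt_top hk hfin).1

/-- The first factor is `v`, independent of `x₀`, so second moments of `γ₁ (x₀)` suffice. -/
lemma integrable_noise_mul_sq (M : IsModel P x₀ v σ) {γ : Strategy}
    (hγ₁ : MemLp (fun ω => γ.γ₁ (x₀ ω)) 2 P) :
    Integrable (fun ω => (obs x₀ v γ ω - γ.bar₁ (x₀ ω)) * γ.γ₁ (x₀ ω) ^ 2) P := by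
  have hv : Integrable v P := by
    refine (M.integrable_pow_v 1).mono' M.measurable_v.aestronglyMeasurable
      (ae_of_all _ fun ω => ?_)
    rw [pow_one, Real.norm_eq_abs]
    linarith
  have := γ.measurable_γ₁
  have h := IndepFun.integrable_mul (X := v) (Y := fun ω => γ.γ₁ (x₀ ω) ^ 2)
    (M.indep.symm.comp (φ := id) (ψ := fun x => γ.γ₁ x ^ 2) (by fun_prop) (by fun_prop))
    hv hγ₁.integrable_sq
  refine h.congr (ae_of_all _ fun ω => ?_)
  have e : obs x₀ v γ ω = γ.bar₁ (x₀ ω) + v ω := rfl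
  simp [e]

lemma condEqsBar_iff (γ : Strategy) :
    CondEqs P x₀ v k σ γ ↔ CondEqsBar P x₀ v k σ γ := by
  unfold CondEqs CondEqsBar
  rw [cubic_eq]
  refine and_congr (and_congr_right fun _ => and_congr_right fun _ =>
    eventually_congr (ae_of_all _ fun ω => ?_)) Iff.rfl
  simp only [Strategy.bar₁]
  constructor <;> intro h <;> linarith

/-- The zero pair costs `E x₀²`. -/
lemma iInf_payoff_lt_top (hx : MemLp x₀ 2 P) :
    ⨅ δ : Strategy, payoff P x₀ v k δ < ⊤ := by
  refine (iInf_le _ ⟨fun _ => 0, fun _ => 0, measurable_const, measurable_const⟩).trans_lt ?_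
  simpa [payoff, state₂, state₁] using hx.integrable_sq.lintegral_lt_top

lemma payoff_lt_top_of_isOptimal (hx : MemLp x₀ 2 P) {γ : Strategy}
    (hopt : IsOptimal P x₀ v k γ) : payoff P x₀ v k γ < ⊤ :=
  hopt ▸ iInf_payoff_lt_top hx

variable [IsProbabilityMeasure P]

/-- If the second controller uses the posterior mean, the cubic term is integrable. -/
lemma integrable_cubic (M : IsModel P x₀ v σ) {γ : Strategy}
    (hbar : MemLp (fun ω => γ.bar₁ (x₀ ω)) 2 P)
    (h2 : ∀ᵐ y, γ.γ₂ y = posteriorMean (P.map x₀) σ γ.bar₁ y) :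
    Integrable (fun ω => (obs x₀ v γ ω - γ.bar₁ (x₀ ω)) *
      (γ.bar₁ (x₀ ω) - γ.γ₂ (obs x₀ v γ ω)) ^ 2) P := by
  have := M.isProbabilityMeasure_map
  have mbar := γ.measurable_bar₁
  have mm : Measurable (posteriorMean (P.map x₀) σ γ.bar₁) := measurable_posteriorMean mbar
  have m1 : Measurable fun ω => γ.bar₁ (x₀ ω) := mbar.comp M.measurable_x₀
  have m2 : Measurable fun ω => γ.γ₂ (obs x₀ v γ ω) := γ.measurable_γ₂.comp (M.measurable_obs γ)
  obtain ⟨C, hC, hb⟩ := exists_abs_posteriorMean_le (μ := P.map x₀) M.sq_pos mbar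
  have hobs : ∀ᵐ ω ∂P, γ.γ₂ (obs x₀ v γ ω) =
      posteriorMean (P.map x₀) σ γ.bar₁ (obs x₀ v γ ω) :=
    (M.ae_obs_iff γ (p := fun y => γ.γ₂ y = posteriorMean (P.map x₀) σ γ.bar₁ y)
      (measurableSet_eq_fun γ.measurable_γ₂ mm)).2 h2
  -- Linear growth of the posterior mean bounds the cubic term by noise moments plus this product,
  -- which is integrable by independence.
  have hprod : Integrable (fun ω => (1 + |v ω|) * γ.bar₁ (x₀ ω) ^ 2) P := by
    refine IndepFun.integrable_mul (X := fun ω => 1 + |v ω|) (Y := fun ω => γ.bar₁ (x₀ ω) ^ 2)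
      ?_ (by simpa using M.integrable_pow_v 1) hbar.integrable_sq
    exact M.indep.symm.comp (φ := fun z => 1 + |z|) (ψ := fun x => γ.bar₁ x ^ 2) (by fun_prop)
      (by fun_prop)
  refine (((M.integrable_pow_v 3).add hprod).const_mul (2 * (C + 1) ^ 2)).mono'
    (((M.measurable_obs γ).sub m1).mul ((m1.sub m2).pow_const 2)).aestronglyMeasurable ?_
  filter_upwards [hobs] with ω hω
  have e : obs x₀ v γ ω = γ.bar₁ (x₀ ω) + v ω := rfl
  have h3 : |obs x₀ v γ ω| ≤ |γ.bar₁ (x₀ ω)| + |v ω| := abs_add_le _ _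
  have h4 := hb (obs x₀ v γ ω)
  rw [← hω] at h4
  have ha := abs_nonneg (γ.bar₁ (x₀ ω))
  have hv := abs_nonneg (v ω)
  have h5 : |γ.bar₁ (x₀ ω) - γ.γ₂ (obs x₀ v γ ω)| ≤
      (C + 1) * (|γ.bar₁ (x₀ ω)| + (1 + |v ω|)) := by
    refine (abs_sub _ _).trans ?_
    nlinarith
  rw [norm_mul, norm_pow, Real.norm_eq_abs, Real.norm_eq_abs,
    show obs x₀ v γ ω - γ.bar₁ (x₀ ω) = v ω by rw [e]; ring]
  simp only [Pi.add_apply]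
  calc |v ω| * |γ.bar₁ (x₀ ω) - γ.γ₂ (obs x₀ v γ ω)| ^ 2
      ≤ (1 + |v ω|) * ((C + 1) * (|γ.bar₁ (x₀ ω)| + (1 + |v ω|))) ^ 2 := by
        gcongr
        linarith
    _ = (1 + |v ω|) * (C + 1) ^ 2 * (|γ.bar₁ (x₀ ω)| + (1 + |v ω|)) ^ 2 := by ring
    _ ≤ (1 + |v ω|) * (C + 1) ^ 2 * (2 * (|γ.bar₁ (x₀ ω)| ^ 2 + (1 + |v ω|) ^ 2)) := by
        gcongr
        exact add_sq_le
    _ = _ := by rw [sq_abs]; ring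

/-- The conditional mean equation of the second controller, in terms of the posterior mean. -/
lemma condMean_iff (M : IsModel P x₀ v σ) {γ : Strategy}
    (hint : Integrable (fun ω => γ.bar₁ (x₀ ω)) P) :
    (∀ᵐ ω ∂P, γ.γ₂ (obs x₀ v γ ω) = (P[fun ω' => γ.bar₁ (x₀ ω') |
        MeasurableSpace.comap (obs x₀ v γ) inferInstance]) ω) ↔
      ∀ᵐ y, γ.γ₂ y = posteriorMean (P.map x₀) σ γ.bar₁ y := by
  have := M.isProbabilityMeasure_map
  rw [← M.ae_obs_iff γ (p := fun y => γ.γ₂ y = posteriorMean (P.map x₀) σ γ.bar₁ y)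
    (measurableSet_eq_fun γ.measurable_γ₂ (measurable_posteriorMean γ.measurable_bar₁))]
  refine eventually_congr ?_
  filter_upwards [M.condExp_obs γ hint] with ω hω
  rw [hω]

lemma condError_iff (M : IsModel P x₀ v σ) {γ : Strategy}
    (hint : Integrable (fun ω => γ.bar₁ (x₀ ω)) P)
    (hW : Integrable (fun ω => γ.bar₁ (x₀ ω) - γ.γ₂ (obs x₀ v γ ω)) P) :
    P[fun ω => γ.bar₁ (x₀ ω) - γ.γ₂ (obs x₀ v γ ω) |
        MeasurableSpace.comap (obs x₀ v γ) inferInstance] =ᵐ[P] 0 ↔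
      ∀ᵐ ω ∂P, γ.γ₂ (obs x₀ v γ ω) = (P[fun ω' => γ.bar₁ (x₀ ω') |
        MeasurableSpace.comap (obs x₀ v γ) inferInstance]) ω := by
  have hγ₂ : Integrable (fun ω => γ.γ₂ (obs x₀ v γ ω)) P :=
    (hint.sub hW).congr (ae_of_all _ fun ω => by simp)
  have hsm : StronglyMeasurable[MeasurableSpace.comap (obs x₀ v γ) inferInstance]
      (fun ω => γ.γ₂ (obs x₀ v γ ω)) :=
    (γ.measurable_γ₂.comp (comap_measurable _)).stronglyMeasurable
  have h1 := condExp_sub hint hγ₂ (MeasurableSpace.comap (obs x₀ v γ) inferInstance)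
  rw [condExp_of_stronglyMeasurable (M.measurable_obs γ).comap_le hsm hγ₂] at h1
  refine eventually_congr ?_
  filter_upwards [h1] with ω hω
  have e : (fun ω => γ.bar₁ (x₀ ω) - γ.γ₂ (obs x₀ v γ ω)) =
    (fun ω => γ.bar₁ (x₀ ω)) - fun ω => γ.γ₂ (obs x₀ v γ ω) := rfl
  rw [e, hω, Pi.sub_apply, Pi.zero_apply, sub_eq_zero, eq_comm]

/-- Given `x₀`, the observation has mean `γ.bar₁ (x₀)`. This removes the control-cost term
multiplied by the score from the bracket. -/
lemma condExp_noise_mul_sq (M : IsModel P x₀ v σ) {γ : Strategy}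
    (hγ₁ : MemLp (fun ω => γ.γ₁ (x₀ ω)) 2 P) :
    P[fun ω => (obs x₀ v γ ω - γ.bar₁ (x₀ ω)) * γ.γ₁ (x₀ ω) ^ 2 |
      MeasurableSpace.comap x₀ inferInstance] =ᵐ[P] 0 := by
  have m1 := γ.measurable_γ₁
  have m2 := γ.measurable_bar₁
  obtain ⟨-, -, h⟩ := M.condExp_x₀ γ (F := fun x y => (y - γ.bar₁ x) * γ.γ₁ x ^ 2)
    (by unfold Function.uncurry; fun_prop) (M.integrable_noise_mul_sq hγ₁)
  filter_upwards [h] with ω hω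
  have hid : Integrable (fun y : ℝ => y)
      (gaussianReal (γ.bar₁ (x₀ ω)) (Real.toNNReal (σ ^ 2))) :=
    (memLp_id_gaussianReal 1).integrable le_rfl
  rw [hω, integral_mul_const, integral_sub hid (integrable_const _), integral_id_gaussianReal]
  simp

/-- The first stationarity condition, solved for the strategy of the first controller. -/
lemma stationary_first_iff (M : IsModel P x₀ v σ) (hk : 0 < k ^ 2) {γ : Strategy}
    (hγ₁ : MemLp (fun ω => γ.γ₁ (x₀ ω)) 2 P)
    (hW : Integrable (fun ω => γ.bar₁ (x₀ ω) - γ.γ₂ (obs x₀ v γ ω)) P) :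
    (Integrable (fun ω => bracket k σ γ.γ₂ (x₀ ω) (γ.γ₁ (x₀ ω)) (obs x₀ v γ ω)) P ∧
      P[fun ω => bracket k σ γ.γ₂ (x₀ ω) (γ.γ₁ (x₀ ω)) (obs x₀ v γ ω) |
        MeasurableSpace.comap x₀ inferInstance] =ᵐ[P] 0) ↔
    (Integrable (fun ω => (obs x₀ v γ ω - γ.bar₁ (x₀ ω)) *
        (γ.bar₁ (x₀ ω) - γ.γ₂ (obs x₀ v γ ω)) ^ 2) P ∧
      ∀ᵐ ω ∂P, γ.γ₁ (x₀ ω) =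
        - (1 / k ^ 2) * (P[fun ω' => γ.bar₁ (x₀ ω') - γ.γ₂ (obs x₀ v γ ω') |
          MeasurableSpace.comap x₀ inferInstance]) ω
        - 1 / (2 * k ^ 2 * σ ^ 2) * (P[fun ω' => (obs x₀ v γ ω' - γ.bar₁ (x₀ ω')) *
            (γ.bar₁ (x₀ ω') - γ.γ₂ (obs x₀ v γ ω')) ^ 2 |
          MeasurableSpace.comap x₀ inferInstance]) ω) := by
  have hσ := M.sq_pos
  set B : Ω → ℝ := fun ω => bracket k σ γ.γ₂ (x₀ ω) (γ.γ₁ (x₀ ω)) (obs x₀ v γ ω) with hB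
  set W : Ω → ℝ := fun ω => γ.bar₁ (x₀ ω) - γ.γ₂ (obs x₀ v γ ω) with hWdef
  set V : Ω → ℝ := fun ω => (obs x₀ v γ ω - γ.bar₁ (x₀ ω)) *
    (γ.bar₁ (x₀ ω) - γ.γ₂ (obs x₀ v γ ω)) ^ 2 with hV
  set Q : Ω → ℝ := fun ω => (obs x₀ v γ ω - γ.bar₁ (x₀ ω)) * γ.γ₁ (x₀ ω) ^ 2 with hQ
  set U : Ω → ℝ := fun ω => γ.γ₁ (x₀ ω) with hU
  have hk' : k ≠ 0 := fun h => by simp [h] at hk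
  have hs' : σ ≠ 0 := fun h => by simp [h] at hσ
  have hBeq : B = ((k ^ 2 / σ ^ 2) • Q + (2 * k ^ 2) • U) + ((1 / σ ^ 2) • V + (2 : ℝ) • W) :=
    funext fun ω => bracket_eq γ ω
  have iQ : Integrable Q P := M.integrable_noise_mul_sq hγ₁
  have iU : Integrable U P := hγ₁.integrable one_le_two
  have iQU : Integrable ((k ^ 2 / σ ^ 2) • Q + (2 * k ^ 2) • U) P := (iQ.smul _).add (iU.smul _)
  -- The other three terms of the bracket are integrable under the hypotheses, so only the cubic one
  -- is at stake.
  have hBV : Integrable B P ↔ Integrable V P := by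
    refine ⟨fun h => ?_, fun h => hBeq ▸ iQU.add ((h.smul _).add (hW.smul _))⟩
    have h1 := ((h.sub iQU).sub (hW.smul (2 : ℝ))).smul (σ ^ 2)
    convert! h1 using 1
    rw [hBeq]
    ext ω
    simp only [Pi.smul_apply, Pi.sub_apply, Pi.add_apply, smul_eq_mul]
    field_simp
    ring
  rw [hBV]
  refine and_congr_right fun iV => ?_
  have cU : P[U | MeasurableSpace.comap x₀ inferInstance] = U := condExp_of_stronglyMeasurable M.measurable_x₀.comap_le
    (γ.measurable_γ₁.comp (comap_measurable _)).stronglyMeasurable iU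
  have hce : P[B | MeasurableSpace.comap x₀ inferInstance] =ᵐ[P] fun ω => 2 * k ^ 2 * U ω + (1 / σ ^ 2 * (P[V | MeasurableSpace.comap x₀ inferInstance]) ω +
      2 * (P[W | MeasurableSpace.comap x₀ inferInstance]) ω) := by
    rw [hBeq]
    filter_upwards [condExp_add iQU ((iV.smul (1 / σ ^ 2)).add (hW.smul (2 : ℝ))) (MeasurableSpace.comap x₀ inferInstance),
      condExp_add (iQ.smul (k ^ 2 / σ ^ 2)) (iU.smul (2 * k ^ 2)) (MeasurableSpace.comap x₀ inferInstance),
      condExp_add (iV.smul (1 / σ ^ 2)) (hW.smul (2 : ℝ)) (MeasurableSpace.comap x₀ inferInstance),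
      condExp_smul (μ := P) (k ^ 2 / σ ^ 2) Q (MeasurableSpace.comap x₀ inferInstance), condExp_smul (μ := P) (2 * k ^ 2) U (MeasurableSpace.comap x₀ inferInstance),
      condExp_smul (μ := P) (1 / σ ^ 2) V (MeasurableSpace.comap x₀ inferInstance),
      condExp_smul (μ := P) (2 : ℝ) W (MeasurableSpace.comap x₀ inferInstance), M.condExp_noise_mul_sq hγ₁] with ω h1 h2 h3 h4 h5 h6 h7 h8
    rw [h1, Pi.add_apply, h2, h3, Pi.add_apply, Pi.add_apply, h4, h5, h6, h7]
    simp only [Pi.smul_apply, smul_eq_mul, cU]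
    rw [show (P[Q | MeasurableSpace.comap x₀ inferInstance]) ω = 0 from h8]
    ring
  refine eventually_congr ?_
  filter_upwards [hce] with ω hω
  rw [hω, Pi.zero_apply]
  change _ ↔ U ω = _
  constructor
  · intro h
    field_simp at h ⊢
    linarith
  · intro h
    rw [h]
    field_simp
    ring

/-- The first conditional equation as an integral equation. -/
lemma condEq_first_iff (M : IsModel P x₀ v σ) (hk : 0 < k ^ 2) {γ : Strategy}
    (hW : Integrable (fun ω => γ.bar₁ (x₀ ω) - γ.γ₂ (obs x₀ v γ ω)) P)
    (hV : Integrable (fun ω => (obs x₀ v γ ω - γ.bar₁ (x₀ ω)) *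
        (γ.bar₁ (x₀ ω) - γ.γ₂ (obs x₀ v γ ω)) ^ 2) P) :
    (∀ᵐ ω ∂P, γ.γ₁ (x₀ ω) =
        - (1 / k ^ 2) * (P[fun ω' => γ.bar₁ (x₀ ω') - γ.γ₂ (obs x₀ v γ ω') |
          MeasurableSpace.comap x₀ inferInstance]) ω
        - 1 / (2 * k ^ 2 * σ ^ 2) * (P[fun ω' => (obs x₀ v γ ω' - γ.bar₁ (x₀ ω')) *
            (γ.bar₁ (x₀ ω') - γ.γ₂ (obs x₀ v γ ω')) ^ 2 |
          MeasurableSpace.comap x₀ inferInstance]) ω) ↔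
      ∀ᵐ x ∂(P.map x₀), Integrable (fun ζ => kernel₁ σ γ.γ₂ (γ.bar₁ x) ζ) volume ∧
        γ.bar₁ x = x - 1 / k ^ 2 * ∫ ζ, kernel₁ σ γ.γ₂ (γ.bar₁ x) ζ := by
  have hσ := M.sq_pos
  have m1 := γ.measurable_γ₁
  have m2 := γ.measurable_γ₂
  have m3 := γ.measurable_bar₁
  obtain ⟨sW, mW, cW⟩ := M.condExp_x₀ γ (F := fun x y => γ.bar₁ x - γ.γ₂ y)
    (by unfold Function.uncurry; fun_prop) hW
  obtain ⟨sV, mV, cV⟩ := M.condExp_x₀ γ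
    (F := fun x y => (y - γ.bar₁ x) * (γ.bar₁ x - γ.γ₂ y) ^ 2)
    (by unfold Function.uncurry; fun_prop) hV
  set IW : ℝ → ℝ := fun x => ∫ y, γ.bar₁ x - γ.γ₂ y
    ∂(gaussianReal (γ.bar₁ x) (Real.toNNReal (σ ^ 2))) with hIW
  set IV : ℝ → ℝ := fun x => ∫ y, (y - γ.bar₁ x) * (γ.bar₁ x - γ.γ₂ y) ^ 2
    ∂(gaussianReal (γ.bar₁ x) (Real.toNNReal (σ ^ 2))) with hIV
  have hP : (∀ᵐ x ∂(P.map x₀), γ.γ₁ x =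
      - (1 / k ^ 2) * IW x - 1 / (2 * k ^ 2 * σ ^ 2) * IV x) ↔
      ∀ᵐ ω ∂P, γ.γ₁ (x₀ ω) =
        - (1 / k ^ 2) * IW (x₀ ω) - 1 / (2 * k ^ 2 * σ ^ 2) * IV (x₀ ω) :=
    ae_map_iff M.measurable_x₀.aemeasurable (measurableSet_eq_fun m1 (by fun_prop))
  refine Iff.trans (Iff.trans (eventually_congr ?_) hP.symm) (eventually_congr ?_)
  · filter_upwards [cW, cV] with ω h1 h2
    rw [h1, h2]
  · filter_upwards [sW, sV] with x h1 h2
    have h3 := (h2.const_mul (1 / (2 * σ ^ 2))).add h1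
    have e : ∀ ζ, kernel₁ σ γ.γ₂ (γ.bar₁ x) ζ =
        (1 / (2 * σ ^ 2) * ((ζ - γ.bar₁ x) * (γ.bar₁ x - γ.γ₂ ζ) ^ 2) + (γ.bar₁ x - γ.γ₂ ζ)) *
          density σ (γ.bar₁ x) ζ := fun ζ => by
      simp only [kernel₁, density, bell]
      ring
    have hint : Integrable (fun ζ => kernel₁ σ γ.γ₂ (γ.bar₁ x) ζ) volume := by
      simp_rw [e]
      exact (integrable_gaussianReal_iff hσ _).1 h3
    have hval : ∫ ζ, kernel₁ σ γ.γ₂ (γ.bar₁ x) ζ = 1 / (2 * σ ^ 2) * IV x + IW x := by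
      simp_rw [e]
      rw [← integral_gaussianReal hσ, integral_add (h2.const_mul _) h1, integral_const_mul]
    rw [hval]
    rw [and_iff_right hint]
    have hk' : k ≠ 0 := fun h => by simp [h] at hk
    have hs' : σ ≠ 0 := fun h => by simp [h] at hσ
    have e2 : - (1 / k ^ 2) * IW x - 1 / (2 * k ^ 2 * σ ^ 2) * IV x =
        -(1 / k ^ 2 * (1 / (2 * σ ^ 2) * IV x + IW x)) := by
      field_simp
      ring
    rw [e2, show γ.bar₁ x = x + γ.γ₁ x from rfl]
    constructor <;> intro h <;> linarith

/-- The integrability clause of the second equation is automatic, because `b * bell σ b y` is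
bounded in `b`. -/
lemma integralEqs_iff (M : IsModel P x₀ v σ) {γ : Strategy} :
    IntegralEqs (P.map x₀) k σ γ ↔
      (∀ᵐ x ∂(P.map x₀), Integrable (fun ζ => kernel₁ σ γ.γ₂ (γ.bar₁ x) ζ) volume ∧
        γ.bar₁ x = x - 1 / k ^ 2 * ∫ ζ, kernel₁ σ γ.γ₂ (γ.bar₁ x) ζ) ∧
      ∀ᵐ y, γ.γ₂ y = posteriorMean (P.map x₀) σ γ.bar₁ y := by
  have := M.isProbabilityMeasure_map
  refine and_congr Iff.rfl (eventually_congr (ae_of_all _ fun y => ?_))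
  exact and_iff_right (integrable_mul_bell M.sq_pos γ.measurable_bar₁ y)

theorem tfae (M : IsModel P x₀ v σ) (hx : MemLp x₀ 2 P) (hk : 0 < k ^ 2) {γ : Strategy}
    (hfin : payoff P x₀ v k γ < ⊤) :
    List.TFAE [Stationary P x₀ v k σ γ, CondEqs P x₀ v k σ γ, CondEqsBar P x₀ v k σ γ,
      IntegralEqs (P.map x₀) k σ γ] := by
  obtain ⟨hγ₁, hW2⟩ := M.memLp_of_payoff_lt_top hk hfin
  have hbar2 := M.memLp_bar₁ hx hk hfin
  have hW := hW2.integrable one_le_two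
  have hbar := hbar2.integrable one_le_two
  have hAB : Stationary P x₀ v k σ γ ↔ CondEqs P x₀ v k σ γ := by
    unfold Stationary CondEqs
    rw [cubic_eq]
    exact and_congr ((M.stationary_first_iff hk hγ₁ hW).trans (and_iff_right hW).symm)
      (((and_iff_right hW).trans (M.condError_iff hbar hW)).trans (and_iff_right hbar).symm)
  have hBD : CondEqs P x₀ v k σ γ ↔ IntegralEqs (P.map x₀) k σ γ := by
    rw [M.integralEqs_iff]
    unfold CondEqs
    rw [cubic_eq]
    constructor
    · rintro ⟨⟨-, hV, h1⟩, -, h2⟩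
      exact ⟨(M.condEq_first_iff hk hW hV).1 h1, (M.condMean_iff hbar).1 h2⟩
    · rintro ⟨h1, h2⟩
      -- The first integral equation yields integrability only for each `x`; joint integrability
      -- comes from the second equation, through linear growth.
      have hV := M.integrable_cubic hbar2 h2
      exact ⟨⟨hW, hV, (M.condEq_first_iff hk hW hV).2 h1⟩, hbar, (M.condMean_iff hbar).2 h2⟩
  tfae_have 2 ↔ 3 := condEqsBar_iff γ
  tfae_have 1 ↔ 2 := hAB
  tfae_have 2 ↔ 4 := hBD
  tfae_finish

/-! ### Optimal strategies -/

/-- Taking `γ₁ x = g x - x` inverts `Strategy.bar₁`, so minimizing the cost is the original problem.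
-/
lemma payoff_of_pair (M : IsModel P x₀ v σ) {g h : ℝ → ℝ} (hg : Measurable g)
    (hh : Measurable h) :
    ∃ γ : Strategy, payoff P x₀ v k γ = cost (P.map x₀) σ k g h := by
  refine ⟨⟨fun x => g x - x, h, hg.sub measurable_id, hh⟩, ?_⟩
  rw [M.payoff_eq_cost]
  congr 1
  funext x
  simp [Strategy.bar₁]

theorem exists_isOptimal (M : IsModel P x₀ v σ) (hx : MemLp x₀ 2 P) (hk : 0 < k ^ 2) :
    ∃ γ : Strategy, IsOptimal P x₀ v k γ := by
  have := M.isProbabilityMeasure_map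
  have hlb : ∀ g h, Measurable g → Measurable h →
      ⨅ δ : Strategy, payoff P x₀ v k δ ≤ cost (P.map x₀) σ k g h := fun g h hg hh => by
    obtain ⟨γ, hγ⟩ := M.payoff_of_pair (k := k) hg hh
    exact hγ ▸ iInf_le _ γ
  have : Nonempty Strategy := ⟨⟨fun _ => 0, fun _ => 0, measurable_const, measurable_const⟩⟩
  obtain ⟨u, -, hu, hmem⟩ := exists_seq_tendsto_sInf
    (Set.range_nonempty fun δ : Strategy => payoff P x₀ v k δ) (OrderBot.bddBelow _)
  choose δ hδ using hmem
  obtain ⟨g, hg, hgm⟩ := exists_cost_minimizer (μ := P.map x₀) M.sq_pos hk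
    (iInf_payoff_lt_top hx) hlb
    ⟨fun n => (δ n).bar₁, fun n => (δ n).γ₂, fun n => (δ n).measurable_bar₁,
      fun n => (δ n).measurable_γ₂, by
        simp_rw [← M.payoff_eq_cost, hδ]
        exact hu⟩
  obtain ⟨γ, hγ⟩ := M.payoff_of_pair (k := k) hg
    (measurable_posteriorMean (μ := P.map x₀) (σ := σ) hg)
  exact ⟨γ, hγ.trans hgm⟩

theorem integralEqs_of_isOptimal (M : IsModel P x₀ v σ) (hx : MemLp x₀ 2 P) (hk : 0 < k ^ 2)
    {γ : Strategy} (hopt : IsOptimal P x₀ v k γ) : IntegralEqs (P.map x₀) k σ γ := by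
  have := M.isProbabilityMeasure_map
  have hfin := payoff_lt_top_of_isOptimal hx hopt
  rw [M.integralEqs_iff]
  refine firstOrder_of_minimizer M.sq_pos hk γ.measurable_bar₁ γ.measurable_γ₂ ?_
    fun g h hg hh => ?_
  · rw [← M.payoff_eq_cost]
    exact hfin.ne
  · obtain ⟨δ, hδ⟩ := M.payoff_of_pair (k := k) hg hh
    rw [← M.payoff_eq_cost, ← hδ, show payoff P x₀ v k γ = _ from hopt]
    exact iInf_le _ δ

end IsModel
end Equations
end Witsenhausen

theorem mainTheorem2 {Ω : Type*} [MeasurableSpace Ω] (P : Measure Ω) [IsProbabilityMeasure P]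
    (x₀ v : Ω → ℝ) (hx₀ : Measurable x₀) (hv : Measurable v) (hindep : IndepFun x₀ v P)
    (hx₀2 : MemLp x₀ 2 P) (k σ : ℝ) (hk : 0 < k ^ 2) (hσ : 0 < σ ^ 2)
    (hvlaw : P.map v = gaussianReal 0 (Real.toNNReal (σ ^ 2))) :
    -- (i) the Radon-Nikodym derivative is the Gaussian ratio, and it is positive
    ((∀ x u y : ℝ, 0 < Witsenhausen.gaussianRatio σ x u y) ∧
      (∀ x u : ℝ, Witsenhausen.channel P v x u ≪ P.map v ∧
        (Witsenhausen.channel P v x u).rnDeriv (P.map v) =ᵐ[P.map v]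
          fun y => ENNReal.ofReal (Witsenhausen.gaussianRatio σ x u y)) ∧
      (∀ γ : Witsenhausen.Strategy,
        Witsenhausen.originalLaw P x₀ v γ ≪ Witsenhausen.referenceLaw P x₀ v ∧
        (Witsenhausen.originalLaw P x₀ v γ).rnDeriv (Witsenhausen.referenceLaw P x₀ v)
          =ᵐ[Witsenhausen.referenceLaw P x₀ v]
          fun z => ENNReal.ofReal (Witsenhausen.gaussianRatio σ z.1 (γ.γ₁ z.1) z.2))) ∧
    -- (ii) optimal strategies exist
    (∃ γ : Witsenhausen.Strategy, Witsenhausen.IsOptimal P x₀ v k γ) ∧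
    -- (iii) optimal strategies satisfy all the systems of equations
    (∀ γ : Witsenhausen.Strategy, Witsenhausen.IsOptimal P x₀ v k γ →
      Witsenhausen.Stationary P x₀ v k σ γ ∧ Witsenhausen.CondEqs P x₀ v k σ γ ∧
      Witsenhausen.CondEqsBar P x₀ v k σ γ ∧
      Witsenhausen.IntegralEqs (P.map x₀) k σ γ) ∧
    -- the systems are equivalent, for all pairs of strategies with finite payoff
    (∀ γ : Witsenhausen.Strategy, Witsenhausen.payoff P x₀ v k γ < ∞ →
      List.TFAE [Witsenhausen.Stationary P x₀ v k σ γ, Witsenhausen.CondEqs P x₀ v k σ γ,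
        Witsenhausen.CondEqsBar P x₀ v k σ γ,
        Witsenhausen.IntegralEqs (P.map x₀) k σ γ]) := by
  have M : Witsenhausen.IsModel P x₀ v σ := ⟨hx₀, hv, hindep, hσ, hvlaw⟩
  refine ⟨M.changeOfMeasure, M.exists_isOptimal hx₀2 hk, fun γ hopt => ?_,
    fun γ hfin => M.tfae hx₀2 hk hfin⟩
  have h := M.tfae hx₀2 hk (Witsenhausen.IsModel.payoff_lt_top_of_isOptimal hx₀2 hopt)
  have hD := M.integralEqs_of_isOptimal hx₀2 hk hopt
  exact ⟨(h.out 3 0).1 hD, (h.out 3 1).1 hD, (h.out 3 2).1 hD, hD⟩
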